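/- Let $\mathcal T=\{n_1b_1+n_2b_2: n_1,n_2\in\mathbb Z\}\subset\mathbb R^2$ be the triangular lattice, with $b_1=(1,0)$, $b_2=\tfrac12(-1,\sqrt3)$, $b_3=-b_1-b_2$; write $x\sim y$ if $|x-y|=1$. For $N\ge1$ let $\Lambda_N=\{n_1b_1+n_2b_2:\lfloor -N/2+1\rfloor\le n_1,n_2\le\lfloor N/2\rfloor\}$. Consider pairs $(u,\sigma)$ with Dirichlet boundary conditions on $\Lambda_N$: $u:\mathcal T\to\mathbb R^2$ vanishes outside $\Lambda_N$, and the slip field $\sigma$ assigns to every ordered nearest neighbor pair $(x,y)$ a lattice vector $\sigma(x,y)=-\sigma(y,x)\in\mathcal T$, which is $0$ if neither $x$ nor $y$ is in $\Lambda_N$. The two-dimensional Ariza–Ortiz energy is $$H_N(u,\sigma)=\frac12\sum_{x\sim y}\big[(u(y)-u(x)-\sigma(x,y))\cdot(y-x)\big]^2,$$ the sum running over the unordered nearest neighbor pairs with $x\in\Lambda_N$ or $y\in\Lambda_N$. For an oriented triangular face $f=(x_1,x_2,x_3)$ (a $3$-cycle of nearest neighbors) let $\mathrm d\sigma(f)=\sigma(x_1,x_2)+\sigma(x_2,x_3)+\sigma(x_3,x_1)$,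 and let $\mathbf 1_f$ be the function on oriented faces that equals $1$ on $f$, $-1$ on $f$ with the opposite orientation, and $0$ elsewhere. With $f_n=(0,b_1,-b_3)+nb_1$, define the charge distributions of a dislocation dipole and of two parallel walls of $M$ dislocations, $$q^n_{\rm dip}=(\mathbf 1_{f_0}-\mathbf 1_{f_n})\,b_1,\qquad q^{M,n,m}_{\rm grain}(f)=\sum_{j=1}^M q^n_{\rm dip}\big(f-jm(b_2-b_3)\big),$$ and let $$E_{\rm dip}(n)=\lim_{N\to\infty}\min\{H_N(u,\sigma):\mathrm d\sigma=q^n_{\rm dip}\},$$ $$E_{\rm grain}(n,m)=\lim_{M\to\infty}\frac1{\sqrt3\,mM}\Big[\lim_{N\to\infty}\min\{H_N(u,\sigma):\mathrm d\sigma=q^{M,n,m}_{\rm grain}\}\Big].$$ Then, for all integers $n,m\ge1$, the minima exist for all sufficiently large $N$ (depending on the charge distribution), all these limits exist, the limit $\lim_{n\to\infty}E_{\rm grain}(n,m)$ exists, and $$E_{\rm dip}(n)=\frac{\log n}{2\pi\sqrt3}+O(1)\quad(n\to\infty),\qquad \lim_{n\to\infty}E_{\rm grain}(n,m)=\frac{\log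 m}{6\pi m}+O\Big(\frac1m\Big)\quad(m\to\infty).$$ -/

import Mathlib

open Filter Topology

namespace ArizaOrtiz

/-- Sites of the triangular lattice, in coordinates: `(n₁, n₂)` stands for the lattice point
`n₁ b₁ + n₂ b₂`. Lattice vectors (Burgers vectors, slips) are written in the same coordinates. -/
abbrev Site : Type := ℤ × ℤ

/-- The point of the plane with coordinates `(n₁, n₂)`: `n₁ b₁ + n₂ b₂` with
`b₁ = (1, 0)` and `b₂ = (-1/2, √3/2)`. -/
noncomputable def pos (x : Site) : EuclideanSpace ℝ (Fin 2) :=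
  (x.1 : ℝ) • !₂[(1 : ℝ), 0] + (x.2 : ℝ) • !₂[-(1 / 2 : ℝ), √3 / 2]

/-- The three positively oriented bond vectors `b₁`, `b₂`, `b₃ = -b₁ - b₂`
(`b 0`, `b 1`, `b 2`, respectively). -/
def b : Fin 3 → Site := ![(1, 0), (0, 1), (-1, -1)]

/-- `x` and `y` are nearest neighbours in the triangular lattice: `y = x ± b_l` for some `l`. -/
def Adj (x y : Site) : Prop := ∃ l : Fin 3, y = x + b l ∨ x = y + b l

/-- Nearest neighbours are exactly the pairs of lattice points at Euclidean distance one. -/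
theorem adj_iff_dist (x y : Site) : Adj x y ↔ dist (pos x) (pos y) = 1 := by
  obtain ⟨a, c⟩ := x
  obtain ⟨a', c'⟩ := y
  have h3 : √3 * √3 = (3 : ℝ) := Real.mul_self_sqrt (by norm_num)
  have key : dist (pos (a, c)) (pos (a', c')) = 1 ↔
      (a - a') * (a - a') - (a - a') * (c - c') + (c - c') * (c - c') = 1 := by
    rw [EuclideanSpace.dist_eq, Real.sqrt_eq_one]
    simp only [Fin.sum_univ_two, Real.dist_eq, sq_abs, pos]
    simp
    rw [← @Int.cast_inj ℝ]
    push_cast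
    constructor <;> intro h <;> nlinarith [h, h3]
  rw [key]
  simp only [Adj, b, Fin.exists_fin_succ, Prod.ext_iff, Prod.fst_add,
    Prod.snd_add]
  simp
  constructor
  · rintro ((⟨h1, h2⟩ | ⟨h1, h2⟩) | (⟨h1, h2⟩ | ⟨h1, h2⟩) | ⟨h1, h2⟩ | ⟨h1, h2⟩) <;> subst h1 h2 <;>
      ring
  · intro h
    generalize hs : a - a' = s at h
    generalize ht : c - c' = t at h
    have hs1 : -1 ≤ s := by nlinarith [sq_nonneg (s - 2 * t)]
    have hs2 : s ≤ 1 := by nlinarith [sq_nonneg (s - 2 * t)]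
    have ht1 : -1 ≤ t := by nlinarith [sq_nonneg (t - 2 * s)]
    have ht2 : t ≤ 1 := by nlinarith [sq_nonneg (t - 2 * s)]
    interval_cases s <;> interval_cases t <;> omega

/-- The box of side `N`: the points `n₁ b₁ + n₂ b₂` with
`⌊-N/2 + 1⌋ ≤ n₁, n₂ ≤ ⌊N/2⌋`. (Division of integers rounds down here.) -/
noncomputable def box (N : ℕ) : Finset Site :=
  Finset.Icc (-(N : ℤ) / 2 + 1) ((N : ℤ) / 2) ×ˢ Finset.Icc (-(N : ℤ) / 2 + 1) ((N : ℤ) / 2)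

/-- A displacement field with Dirichlet boundary conditions: it vanishes outside `Λ`. -/
def IsDisplacement (Λ : Finset Site) (u : Site → EuclideanSpace ℝ (Fin 2)) : Prop :=
  ∀ x, x ∉ Λ → u x = 0

/-- A slip field with Dirichlet boundary conditions: a lattice-valued function of the oriented
nearest neighbour bonds which is odd under reversal of the bond and vanishes on the bonds that do
not touch `Λ`. (Its values at pairs that are not bonds play no role.) -/
structure IsSlipField (Λ : Finset Site) (σ : Site → Site → Site) : Prop where
  odd : ∀ x y, Adj x y → σ y x = -σ x y
  supp : ∀ x y, Adj x y → x ∉ Λ → y ∉ Λ → σ x y = 0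

/-- The Ariza-Ortiz energy `½ ∑ [(u(y) - u(x) - σ(x,y)) · (y - x)]²`, the sum being over the
unordered nearest neighbour pairs touching `Λ`. Each such pair is listed once, as
`(x, x + b_l)` with `x ∈ Λ` or `x + b_l ∈ Λ`. -/
noncomputable def energy (Λ : Finset Site) (u : Site → EuclideanSpace ℝ (Fin 2))
    (σ : Site → Site → Site) : ℝ :=
  (1 / 2) * ∑ l : Fin 3, ∑ x ∈ Λ ∪ Λ.image (fun y => y - b l),
    (inner ℝ (u (x + b l) - u x - pos (σ x (x + b l))) (pos (b l))) ^ 2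

/-- The dislocation part `dσ(x,y,z) = σ(x,y) + σ(y,z) + σ(z,x)` of a slip field. -/
def d (σ : Site → Site → Site) (x y z : Site) : Site := σ x y + σ y z + σ z x

/-- `dσ = q` on all the oriented triangular faces (3-cycles of nearest neighbours). -/
def HasCharge (σ : Site → Site → Site) (q : Site → Site → Site → Site) : Prop :=
  ∀ x y z, Adj x y → Adj y z → Adj z x → d σ x y z = q x y z

/-- The indicator `1_f` of the oriented face `f = (v₁, v₂, v₃)`, as a 2-form: `1` on `f` (up to
cyclic permutations), `-1` on `f` with the opposite orientation, `0` on the other faces. -/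
def faceInd (v₁ v₂ v₃ : Site) (x y z : Site) : ℤ :=
  if (x, y, z) = (v₁, v₂, v₃) ∨ (x, y, z) = (v₂, v₃, v₁) ∨ (x, y, z) = (v₃, v₁, v₂) then 1
  else if (x, y, z) = (v₁, v₃, v₂) ∨ (x, y, z) = (v₃, v₂, v₁) ∨ (x, y, z) = (v₂, v₁, v₃) then -1
  else 0

/-- The charge `(1_{f_0} - 1_{f_n}) b₁` of a dislocation dipole, where
`f_n = (0, b₁, -b₃) + n b₁`. -/
def qDip (n : ℕ) (x y z : Site) : Site :=
  (faceInd 0 (b 0) (-b 2) x y z -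
    faceInd (n • b 0) (b 0 + n • b 0) (-b 2 + n • b 0) x y z) • b 0

/-- The charge `∑_{j=1}^M q_dip(f - j m (b₂ - b₃))` of two parallel walls of `M` dislocations. -/
def qGrain (M n m : ℕ) (x y z : Site) : Site :=
  ∑ j ∈ Finset.Icc 1 M,
    qDip n (x - (j * m) • (b 1 - b 2)) (y - (j * m) • (b 1 - b 2)) (z - (j * m) • (b 1 - b 2))

/-- The energies, in the box of side `N` with Dirichlet boundary conditions, of all the pairs
`(u, σ)` such that `dσ = q`. -/
def energies (N : ℕ) (q : Site → Site → Site → Site) : Set ℝ :=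
  {E | ∃ u σ, IsDisplacement (box N) u ∧ IsSlipField (box N) σ ∧ HasCharge σ q ∧
    energy (box N) u σ = E}

/-- `E = lim_{N → ∞} min {H(u, σ) : dσ = q}`: for all large boxes the minimum exists, and these
minima converge to `E`. -/
def IsLimMinEnergy (q : Site → Site → Site → Site) (E : ℝ) : Prop :=
  ∃ e : ℕ → ℝ, (∀ᶠ N in atTop, IsLeast (energies N q) (e N)) ∧ Tendsto e atTop (𝓝 E)

/-- `E` is the energy per unit length of the pair of walls at distance `n` with spacing `m √3`:
`E = lim_{M → ∞} (√3 m M)⁻¹ lim_{N → ∞} min {H(u, σ) : dσ = q_grain}`. -/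
def IsGrainEnergy (n m : ℕ) (E : ℝ) : Prop :=
  ∃ e : ℕ → ℝ, (∀ M, 1 ≤ M → IsLimMinEnergy (qGrain M n m) (e M)) ∧
    Tendsto (fun M : ℕ => 1 / (√3 * m * M) * e M) atTop (𝓝 E)

end ArizaOrtiz

namespace ArizaOrtiz

open MeasureTheory

/-! Everything becomes explicit in Fourier space. Two slip fields with the same charge differ by a
closed field with Dirichlet conditions, hence by the gradient of a lattice-valued function
(`exists_potential`), and the displacement absorbs that gradient. So one slip σ may be fixed and
only u varies. On a box this is a finite-dimensional least squares problem, which has a minimum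
(`exists_isLeast_energies`). As the boxes grow, the minima tend to the infimum over finitely
supported displacements (`isLimMinEnergy_of_slip`).

The energy sees u only through its projections v_l = u·b_l, whose only constraint is v_0 + v_1 + v_2
= 0. By Parseval the problem decouples over frequencies: minimize ∑ |y_l V_l - T_l|² subject to ∑
V_l = 0. The form `incompat` does not see V, so Cauchy–Schwarz gives the bound `density`. The
optimizer, made continuous by a regularization and then approximated by trigonometric polynomials,
shows that the integral of `density` is the infimum (`minStrain_le`, `exists_strain_lt`).

Both charges are sums of translates of the dipole with n = 1, so their densities are that of one
dipole times the squared modulus of a sum of characters. In coordinates (p, d), where b₁ has phase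
2p and b₂ - b₃ has phase 2d, one dipole has density sin²p · `profile p d`. A row of n dipoles turns
sin²p into sin²(np). A wall adds the Fejér-type factor |∑ exp(2imdj)|², which after division by M
concentrates, as M → ∞, at the m frequencies d = πj/m. As n → ∞, Riemann–Lebesgue replaces sin²(np)
by its mean 1/2.

The logarithms come from the two singularities of `profile`, at (0,0) and (π,π). There it equals
4d²/(3p² + d²)² up to a bounded error (`abs_profile_sub_le`). Integrating this kernel over d gives
π/(√3 p), and over p gives π/(√3 d), again up to bounded errors. For the dipole, sin²(np)/sin p = ∑
sin((2k+1)p) integrates to ∑ 2/(2k+1), which is log n + O(1). For the walls, the sum of 1/d + 1/(π -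
d) over d = πj/m, 0 < j < m, is a harmonic sum of order m log m. -/

/-! ### Lattice vectors and boxes -/

theorem pos_add (x y : Site) : pos (x + y) = pos x + pos y := by
  simp only [pos, Prod.fst_add, Prod.snd_add, Int.cast_add, add_smul]
  abel

theorem pos_neg (x : Site) : pos (-x) = -pos x := by
  simp only [pos, Prod.fst_neg, Prod.snd_neg, Int.cast_neg, neg_smul]
  abel

theorem pos_zero : pos 0 = 0 := by simp [pos]

theorem pos_sub (x y : Site) : pos (x - y) = pos x - pos y := by
  rw [sub_eq_add_neg, pos_add, pos_neg, ← sub_eq_add_neg]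

theorem adj_add_b (x : Site) (l : Fin 3) : Adj x (x + b l) := ⟨l, Or.inl rfl⟩

theorem mem_box {N : ℕ} {x : Site} : x ∈ box N ↔
    (-(N : ℤ) / 2 + 1 ≤ x.1 ∧ x.1 ≤ (N : ℤ) / 2) ∧ (-(N : ℤ) / 2 + 1 ≤ x.2 ∧ x.2 ≤ (N : ℤ) / 2) := by
  simp [box]

theorem eventually_subset_box (K : Finset Site) : ∀ᶠ N in atTop, K ⊆ box N := by
  induction K using Finset.induction_on with
  | empty => simp
  | insert x K _ ih =>
    filter_upwards [ih, eventually_ge_atTop (2 * x.1.natAbs + 2 * x.2.natAbs + 2)] with N h1 h2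
    refine Finset.insert_subset ?_ h1
    rw [mem_box]
    omega

/-! ### Gauge invariance and existence of minimizers -/

/-- A closed slip field with Dirichlet boundary conditions is exact, with a potential which
vanishes outside the box. -/
theorem exists_potential {N : ℕ} {σ : Site → Site → Site} (hσ : IsSlipField (box N) σ)
    (hd : HasCharge σ 0) :
    ∃ v : Site → Site, (∀ x, x ∉ box N → v x = 0) ∧ ∀ x y, Adj x y → σ x y = v y - v x := by
  have a1 : ∀ a c : ℤ, Adj (a, c) (a + 1, c) := fun a c => ⟨0, Or.inl (by simp [b])⟩
  have a2 : ∀ a c : ℤ, Adj (a, c) (a, c + 1) := fun a c => ⟨1, Or.inl (by simp [b])⟩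
  have a3 : ∀ a c : ℤ, Adj (a + 1, c + 1) (a, c) := fun a c => ⟨2, Or.inl (by simp [b])⟩
  have t1 : ∀ a c : ℤ, σ (a, c) (a + 1, c) + σ (a + 1, c) (a + 1, c + 1) +
      σ (a + 1, c + 1) (a, c) = 0 := fun a c => hd _ _ _ (a1 a c) (a2 _ _) (a3 _ _)
  have t2 : ∀ a c : ℤ, σ (a, c) (a, c + 1) + σ (a, c + 1) (a + 1, c + 1) +
      σ (a + 1, c + 1) (a, c) = 0 := fun a c => hd _ _ _ (a2 a c) (a1 _ _) (a3 _ _)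
  -- The two faces of a unit cell share the diagonal; equating their circulations eliminates it.
  have step : ∀ a c : ℤ, σ (a, c + 1) (a + 1, c + 1) =
      σ (a, c) (a + 1, c) + σ (a + 1, c) (a + 1, c + 1) - σ (a, c) (a, c + 1) := by
    intro a c
    have := (t1 a c).trans (t2 a c).symm
    rw [add_left_inj] at this
    rw [this]; abel
  -- `L` is the row just below the box, where the slips start to vanish; the potential sums the
  -- vertical slips upwards from it.
  set L : ℤ := -(N : ℤ) / 2 with hL
  let v : Site → Site := fun x => ∑ t ∈ Finset.range (x.2 - L).toNat, σ (x.1, L + t) (x.1, L + t + 1)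
  have vlow : ∀ a c : ℤ, c ≤ L → v (a, c) = 0 := by
    intro a c h
    simp only [v]
    rw [Int.toNat_eq_zero.2 (by omega)]; simp
  have vert : ∀ a c : ℤ, σ (a, c) (a, c + 1) = v (a, c + 1) - v (a, c) := by
    intro a c
    by_cases h : L ≤ c
    · simp only [v]
      have e1 : (c + 1 - L).toNat = (c - L).toNat + 1 := by omega
      have e2 : L + ((c - L).toNat : ℤ) = c := by omega
      rw [e1, Finset.sum_range_succ, e2]; abel
    · rw [vlow _ _ (by omega), vlow _ _ (by omega), sub_zero]
      exact hσ.supp _ _ (a2 _ _) (by rw [mem_box]; simp only; omega)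
        (by rw [mem_box]; simp only; omega)
  have horlow : ∀ a c : ℤ, c ≤ L → σ (a, c) (a + 1, c) = 0 := fun a c h =>
    hσ.supp _ _ (a1 _ _) (by rw [mem_box]; simp only; omega) (by rw [mem_box]; simp only; omega)
  have horup : ∀ (k : ℕ) (a : ℤ), σ (a, L + k) (a + 1, L + k) = v (a + 1, L + k) - v (a, L + k) := by
    intro k
    induction k with
    | zero =>
      intro a
      simp only [Nat.cast_zero, add_zero]
      rw [horlow _ _ le_rfl, vlow _ _ le_rfl, vlow _ _ le_rfl, sub_zero]
    | succ k ih =>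
      intro a
      have e : L + ((k + 1 : ℕ) : ℤ) = L + k + 1 := by push_cast; ring
      rw [e, step, ih, vert, vert]; abel
  have hor : ∀ a c : ℤ, σ (a, c) (a + 1, c) = v (a + 1, c) - v (a, c) := by
    intro a c
    by_cases h : L ≤ c
    · obtain ⟨k, rfl⟩ := Int.le.dest h
      exact horup k a
    · rw [horlow _ _ (by omega), vlow _ _ (by omega), vlow _ _ (by omega), sub_zero]
  have diag : ∀ a c : ℤ, σ (a + 1, c + 1) (a, c) = v (a, c) - v (a + 1, c + 1) := by
    intro a c
    have := t1 a c
    rw [hor, vert] at this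
    rw [eq_comm, ← sub_eq_zero, ← neg_eq_zero, ← this]; abel
  have vside : ∀ a c : ℤ, (a ≤ L ∨ (N : ℤ) / 2 < a) → v (a, c) = 0 := by
    intro a c h
    refine Finset.sum_eq_zero fun t _ => ?_
    exact hσ.supp _ _ (a2 _ _) (by rw [mem_box]; simp only; omega)
      (by rw [mem_box]; simp only; omega)
  -- Above the box the vertical sums need not vanish term by term. Instead, walk left from the
  -- column just right of the box, where `v = 0`, along horizontal bonds that carry no slip.
  have vtop : ∀ (k : ℕ) (c : ℤ), (N : ℤ) / 2 < c → v ((N : ℤ) / 2 + 1 - k, c) = 0 := by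
    intro k c hc
    induction k with
    | zero => exact vside _ _ (by simp)
    | succ k ih =>
      have e := hor ((N : ℤ) / 2 + 1 - (k + 1 : ℕ)) c
      have e' : (N : ℤ) / 2 + 1 - ((k + 1 : ℕ) : ℤ) + 1 = (N : ℤ) / 2 + 1 - k := by push_cast; ring
      rw [hσ.supp _ _ (a1 _ _) (by rw [mem_box]; simp only; omega)
        (by rw [mem_box]; simp only; omega), e', ih, zero_sub] at e
      exact neg_eq_zero.1 e.symm
  have hb : ∀ x l, σ x (x + b l) = v (x + b l) - v x := by
    rintro ⟨a, c⟩ l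
    fin_cases l
    · simpa [b] using hor a c
    · simpa [b] using vert a c
    · have := diag (a - 1) (c - 1)
      simpa [b, sub_eq_add_neg] using this
  refine ⟨v, ?_, ?_⟩
  · rintro ⟨a, c⟩ hx
    rw [mem_box] at hx
    simp only at hx
    by_cases h1 : a ≤ L ∨ (N : ℤ) / 2 < a
    · exact vside _ _ h1
    by_cases h2 : c ≤ L
    · exact vlow _ _ h2
    have := vtop ((N : ℤ) / 2 + 1 - a).toNat c (by omega)
    rwa [show (N : ℤ) / 2 + 1 - (((N : ℤ) / 2 + 1 - a).toNat : ℤ) = a by omega] at this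
  · rintro x y ⟨l, rfl | rfl⟩
    · exact hb x l
    · rw [hσ.odd _ _ (adj_add_b y l), hb]; abel

theorem energy_add_d (Λ : Finset Site) (u : Site → EuclideanSpace ℝ (Fin 2))
    {σ σ' : Site → Site → Site} (v : Site → Site)
    (h : ∀ x y, Adj x y → σ' x y = σ x y + (v y - v x)) :
    energy Λ u σ' = energy Λ (fun x => u x - pos (v x)) σ := by
  unfold energy
  congr 1
  refine Finset.sum_congr rfl fun l _ => Finset.sum_congr rfl fun x _ => ?_
  have e : u (x + b l) - u x - pos (σ' x (x + b l)) =
      u (x + b l) - pos (v (x + b l)) - (u x - pos (v x)) - pos (σ x (x + b l)) := by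
    rw [h _ _ (adj_add_b x l), pos_add, pos_sub]
    module
  rw [e]

/-- Any other slip with the charge `q` differs from `σ` by a closed field, hence by a gradient that
the displacement absorbs. The discrete variable thus disappears from the minimization. -/
theorem mem_energies_iff {N : ℕ} {σ : Site → Site → Site} {q : Site → Site → Site → Site}
    (hσ : IsSlipField (box N) σ) (hq : HasCharge σ q) (E : ℝ) :
    E ∈ energies N q ↔ ∃ u, IsDisplacement (box N) u ∧ energy (box N) u σ = E := by
  constructor
  · rintro ⟨u, σ', hu, hσ', hq', rfl⟩
    obtain ⟨v, hv0, hv⟩ := exists_potential (N := N) (σ := fun x y => σ' x y - σ x y)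
      ⟨fun x y h => by rw [hσ.odd x y h, hσ'.odd x y h]; abel,
        fun x y h h1 h2 => by rw [hσ.supp x y h h1 h2, hσ'.supp x y h h1 h2, sub_zero]⟩
      (by
        intro x y z h1 h2 h3
        have := (hq' x y z h1 h2 h3).trans (hq x y z h1 h2 h3).symm
        simp only [d] at this ⊢
        rw [Pi.zero_apply, Pi.zero_apply, Pi.zero_apply, ← sub_eq_zero.2 this]
        abel)
    refine ⟨fun x => u x - pos (v x), fun x hx => ?_, ?_⟩
    · simp only [hu x hx, hv0 x hx, pos_zero, sub_zero]
    · rw [energy_add_d (σ := σ) (σ' := σ') (v := v)]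
      intro x y h
      rw [← hv x y h]; abel
  · rintro ⟨u, hu, rfl⟩
    exact ⟨u, σ, hu, hσ, hq, rfl⟩

/-- With `σ` fixed, the energy is half the squared distance from a fixed vector to a point of a
subspace of a finite-dimensional Euclidean space; the orthogonal projection attains the minimum. -/
theorem exists_isLeast_energies {N : ℕ} {σ : Site → Site → Site} {q : Site → Site → Site → Site}
    (hσ : IsSlipField (box N) σ) (hq : HasCharge σ q) : ∃ e, IsLeast (energies N q) e := by
  let S : Fin 3 → Finset Site := fun l => box N ∪ (box N).image (fun y => y - b l)
  let V : Submodule ℝ (Site → EuclideanSpace ℝ (Fin 2)) :=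
    { carrier := {u | IsDisplacement (box N) u}
      zero_mem' := fun x _ => rfl
      add_mem' := fun {u v} hu hv x hx => by
        rw [Pi.add_apply, hu x hx, hv x hx, add_zero]
      smul_mem' := fun c u hu x hx => by rw [Pi.smul_apply, hu x hx, smul_zero] }
  let A : (Site → EuclideanSpace ℝ (Fin 2)) →ₗ[ℝ] EuclideanSpace ℝ (Σ l : Fin 3, {x // x ∈ S l}) :=
    { toFun := fun u => WithLp.toLp 2 fun i => inner ℝ (u (i.2 + b i.1) - u i.2) (pos (b i.1))
      map_add' := fun u v => by
        ext i
        simp only [Pi.add_apply, PiLp.add_apply, ← inner_add_left]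
        congr 1; abel
      map_smul' := fun c u => by
        ext i
        simp only [Pi.smul_apply, PiLp.smul_apply, smul_eq_mul, RingHom.id_apply, ← smul_sub,
          real_inner_smul_left] }
  let t : EuclideanSpace ℝ (Σ l : Fin 3, {x // x ∈ S l}) :=
    WithLp.toLp 2 fun i => inner ℝ (pos (σ i.2 (i.2 + b i.1))) (pos (b i.1))
  have hE : ∀ u, energy (box N) u σ = 1 / 2 * ‖t - A u‖ ^ 2 := by
    intro u
    rw [norm_sub_rev, EuclideanSpace.norm_sq_eq, Fintype.sum_sigma]
    unfold energy
    congr 1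
    refine Finset.sum_congr rfl fun l _ => ?_
    rw [← Finset.sum_coe_sort]
    refine Finset.sum_congr rfl fun x _ => ?_
    rw [Real.norm_eq_abs, sq_abs]
    simp only [A, t, LinearMap.coe_mk, AddHom.coe_mk, PiLp.sub_apply]
    rw [← inner_sub_left]
  obtain ⟨u₀, hu₀, h0⟩ := (V.map A).starProjection_apply_mem t
  refine ⟨energy (box N) u₀ σ, (mem_energies_iff hσ hq _).2 ⟨u₀, hu₀, rfl⟩, ?_⟩
  intro E hEm
  obtain ⟨u, hu, rfl⟩ := (mem_energies_iff hσ hq _).1 hEm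
  rw [hE, hE, h0, Submodule.starProjection_minimal]
  have : ⨅ x : ↥(V.map A), ‖t - x‖ ≤ ‖t - A u‖ :=
    ciInf_le ⟨0, by rintro _ ⟨x, rfl⟩; exact norm_nonneg _⟩
      (⟨A u, Submodule.mem_map_of_mem hu⟩ : ↥(V.map A))
  have h0' : 0 ≤ ⨅ x : ↥(V.map A), ‖t - x‖ := Real.iInf_nonneg fun x => norm_nonneg _
  gcongr

/-! ### Fourier analysis on the lattice -/

/-- The character of the lattice `ℤ × ℤ` attached to the site `x`, as a function on the torus. -/
noncomputable def mono (x : Site) : C(UnitAddTorus (Fin 2), ℂ) := UnitAddTorus.mFourier ![x.1, x.2]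

/-- The Fourier transform of a finitely supported function on the lattice. -/
noncomputable def hat : (Site →₀ ℂ) →ₗ[ℂ] C(UnitAddTorus (Fin 2), ℂ) :=
  Finsupp.linearCombination ℂ mono

/-- Coordinates `(p, d)` on the torus, adapted to the directions `b₁` and `b₂ - b₃`. -/
noncomputable def torusPt (k : ℝ × ℝ) : UnitAddTorus (Fin 2) :=
  ![((k.1 / Real.pi : ℝ) : AddCircle (1 : ℝ)), (((k.2 - k.1) / (2 * Real.pi) : ℝ) : AddCircle (1 : ℝ))]

/-- Lebesgue measure on a fundamental cell for the coordinates `(p, d)`. -/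
noncomputable def cell : Measure (ℝ × ℝ) :=
  (volume.restrict (Set.Ioc 0 (2 * Real.pi))).prod (volume.restrict (Set.Ioc 0 Real.pi))

instance : IsFiniteMeasure cell := by unfold cell; infer_instance

theorem mono_torusPt (x : Site) (k : ℝ × ℝ) :
    mono x (torusPt k) = Complex.exp (Complex.I * (k.1 * (2 * x.1 - x.2) + k.2 * x.2)) := by
  have h := Complex.ofReal_ne_zero.2 Real.pi_ne_zero
  simp only [mono, UnitAddTorus.mFourier, torusPt, ContinuousMap.coe_mk, Fin.prod_univ_two,
    Matrix.cons_val_zero, Matrix.cons_val_one, fourier_coe_apply]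
  rw [← Complex.exp_add]
  congr 1
  push_cast
  field_simp
  ring

theorem mono_zero : mono 0 = 1 := by
  have : (![((0 : Site)).1, (0 : Site).2] : Fin 2 → ℤ) = 0 := by ext i; fin_cases i <;> rfl
  rw [mono, this, UnitAddTorus.mFourier_zero]

theorem mono_add (x y : Site) : mono (x + y) = mono x * mono y := by
  have : (![(x + y).1, (x + y).2] : Fin 2 → ℤ) = ![x.1, x.2] + ![y.1, y.2] := by
    ext i; fin_cases i <;> rfl
  ext t
  rw [mono, this, UnitAddTorus.mFourier_add]; rfl

theorem continuous_torusPt : Continuous torusPt := by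
  refine continuous_pi fun i => ?_
  fin_cases i
  · exact (AddCircle.continuous_mk' 1).comp (by fun_prop)
  · exact (AddCircle.continuous_mk' 1).comp (by fun_prop)

theorem integral_exp_int_mul (a : ℤ) :
    ∫ p in Set.Ioc 0 (2 * Real.pi), Complex.exp (Complex.I * (p * a)) =
      if a = 0 then ((2 * Real.pi : ℝ) : ℂ) else 0 := by
  rw [← intervalIntegral.integral_of_le (by positivity)]
  split_ifs with h
  · subst h; simp
  · have h1 : Complex.I * a ≠ 0 := by simp [h]
    have := integral_exp_mul_complex (a := 0) (b := 2 * Real.pi) h1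
    simp_rw [show ∀ p : ℝ, Complex.I * (p * a) = Complex.I * a * p by intro p; ring]
    rw [this, show Complex.I * a * ((2 * Real.pi : ℝ) : ℂ) = a * (2 * Real.pi * Complex.I) by
      push_cast; ring, Complex.exp_int_mul_two_pi_mul_I]
    simp

theorem integral_exp_two_int_mul (a : ℤ) :
    ∫ p in Set.Ioc 0 Real.pi, Complex.exp (Complex.I * (p * (2 * a))) =
      if a = 0 then (Real.pi : ℂ) else 0 := by
  rw [← intervalIntegral.integral_of_le (by positivity)]
  split_ifs with h
  · subst h; simp
  · have h1 : Complex.I * (2 * a) ≠ 0 := by simp [h]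
    have := integral_exp_mul_complex (a := 0) (b := Real.pi) h1
    simp_rw [show ∀ p : ℝ, Complex.I * (p * (2 * a)) = Complex.I * (2 * a) * p by intro p; ring]
    rw [this, show Complex.I * (2 * a) * (Real.pi : ℂ) = a * (2 * Real.pi * Complex.I) by ring, Complex.exp_int_mul_two_pi_mul_I]
    simp

theorem integral_mono (x : Site) :
    ∫ k, mono x (torusPt k) ∂cell = if x = 0 then ((2 * Real.pi ^ 2 : ℝ) : ℂ) else 0 := by
  obtain ⟨x1, x2⟩ := x
  simp_rw [mono_torusPt, mul_add, Complex.exp_add]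
  rw [cell, integral_prod_mul (fun p : ℝ => Complex.exp (Complex.I * (p * (2 * (x1 : ℂ) - x2))))
    (fun d : ℝ => Complex.exp (Complex.I * (d * (x2 : ℂ))))]
  have e := integral_exp_int_mul (2 * x1 - x2)
  push_cast at e
  rw [e]
  -- The `p` integral kills all sites but those with `x2 = 2 * x1`; on these the phase in `d` is `2
  -- * x1 * d`, so a half period of length π is enough for orthogonality.
  by_cases h : 2 * x1 - x2 = 0
  · have e' : x2 = 2 * x1 := by omega
    subst e'
    have e2 := integral_exp_two_int_mul x1
    rw [Int.cast_mul, Int.cast_ofNat]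
    rw [e2]
    by_cases h1 : x1 = 0
    · subst h1; simp; ring
    · simp [h1]
  · rw [if_neg h, if_neg, zero_mul]
    rintro h'
    rw [Prod.mk_eq_zero] at h'
    omega

theorem integrable_torus {E : Type*} [NormedAddCommGroup E] {f : UnitAddTorus (Fin 2) → E}
    (hf : Continuous f) :
    Integrable (fun k => f (torusPt k)) cell := by
  obtain ⟨C, hC⟩ := (isCompact_range hf).isBounded.exists_norm_le
  refine Integrable.of_bound ((hf.comp continuous_torusPt).aestronglyMeasurable) C ?_
  exact Eventually.of_forall fun k => hC _ ⟨_, rfl⟩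

theorem mono_neg (x : Site) (t) : mono (-x) t = starRingEnd ℂ (mono x t) := by
  have : (![(-x).1, (-x).2] : Fin 2 → ℤ) = -![x.1, x.2] := by
    ext i; fin_cases i <;> rfl
  rw [mono, this, UnitAddTorus.mFourier_neg]; rfl

theorem hat_apply (f : Site →₀ ℂ) (t) : hat f t = ∑ x ∈ f.support, f x * mono x t := by
  rw [hat, Finsupp.linearCombination_apply, Finsupp.sum, ContinuousMap.sum_apply]
  rfl

theorem parseval (f : Site →₀ ℂ) :
    ∫ k, ‖hat f (torusPt k)‖ ^ 2 ∂cell = 2 * Real.pi ^ 2 * f.sum fun _ z => ‖z‖ ^ 2 := by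
  have key : ∀ t, (((‖hat f t‖ ^ 2 : ℝ)) : ℂ) =
      ∑ x ∈ f.support, ∑ y ∈ f.support, f x * starRingEnd ℂ (f y) * mono (x - y) t := by
    intro t
    rw [Complex.ofReal_pow, ← Complex.mul_conj', hat_apply, map_sum, Finset.sum_mul_sum]
    refine Finset.sum_congr rfl fun x _ => Finset.sum_congr rfl fun y _ => ?_
    rw [sub_eq_add_neg, mono_add, ContinuousMap.mul_apply, mono_neg, map_mul]
    ring
  apply Complex.ofReal_injective
  rw [← integral_complex_ofReal]
  simp_rw [key]
  rw [integral_finsetSum]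
  · simp_rw [Finsupp.sum]
    push_cast
    rw [Finset.mul_sum]
    refine Finset.sum_congr rfl fun x hx => ?_
    rw [integral_finsetSum]
    · simp_rw [integral_const_mul, integral_mono, sub_eq_zero]
      simp only [mul_ite, mul_zero, Finset.sum_ite_eq, hx, if_true]
      rw [Complex.mul_conj']
      push_cast; ring
    · intro y _
      exact integrable_torus (f := fun t => f x * starRingEnd ℂ (f y) * mono (x - y) t)
        (by fun_prop)
  · intro x _
    exact integrable_torus (f := fun t => ∑ y ∈ f.support, f x * starRingEnd ℂ (f y) * mono (x - y) t)
        (by fun_prop)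

theorem denseRange_hat : DenseRange hat := by
  have h : (Set.range mono) = Set.range (UnitAddTorus.mFourier (d := Fin 2)) := by
    ext g
    constructor
    · rintro ⟨x, rfl⟩; exact ⟨_, rfl⟩
    · rintro ⟨n, rfl⟩
      refine ⟨(n 0, n 1), ?_⟩
      rw [mono]; congr 1; ext i; fin_cases i <;> rfl
  have h2 := UnitAddTorus.span_mFourier_closure_eq_top (d := Fin 2)
  rw [← h, ← Finsupp.range_linearCombination] at h2
  intro g
  have : g ∈ (LinearMap.range hat).topologicalClosure := by
    rw [show LinearMap.range hat = _ from rfl, hat, h2]; trivial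
  exact this

/-- Transfers uniform approximation by trigonometric polynomials to the quadratic energy. -/
theorem continuous_integral_norm_sq :
    Continuous fun f : C(UnitAddTorus (Fin 2), ℂ) => ∫ k, ‖f (torusPt k)‖ ^ 2 ∂cell := by
  rw [continuous_iff_continuousAt]
  intro f₀
  have h0 : ∀ᶠ f in 𝓝 f₀, ‖f‖ < ‖f₀‖ + 1 :=
    continuous_norm.continuousAt.eventually_lt_const (by linarith)
  refine continuousAt_of_dominated (bound := fun _ => (‖f₀‖ + 1) ^ 2) ?_ ?_ (integrable_const _) ?_
  · refine Eventually.of_forall fun f => ?_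
    exact ((f.continuous.comp continuous_torusPt).norm.pow 2).aestronglyMeasurable
  · filter_upwards [h0] with f hf
    refine Eventually.of_forall fun k => ?_
    rw [Real.norm_eq_abs, abs_of_nonneg (by positivity)]
    have := f.norm_coe_le_norm (torusPt k)
    gcongr
    linarith
  · refine Eventually.of_forall fun k => ?_
    exact Continuous.continuousAt (by fun_prop)

/-- The function `x ↦ f (x + a)`. -/
noncomputable def shift (a : Site) (f : Site →₀ ℂ) : Site →₀ ℂ := f.mapDomain (fun x => x - a)

theorem shift_apply (a : Site) (f : Site →₀ ℂ) (x : Site) : shift a f x = f (x + a) := by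
  have := Finsupp.mapDomain_apply (sub_left_injective (b := a)) f (x + a)
  rwa [add_sub_cancel_right] at this

theorem hat_shift (a : Site) (f : Site →₀ ℂ) : hat (shift a f) = mono (-a) * hat f := by
  rw [shift, hat, Finsupp.linearCombination_mapDomain]
  rw [Finsupp.linearCombination_apply, Finsupp.linearCombination_apply, Finsupp.mul_sum]
  refine Finsupp.sum_congr fun x _ => ?_
  rw [Function.comp_apply, sub_eq_add_neg, mono_add, mul_smul_comm, mul_comm]

/-! ### Minimization at a fixed frequency -/

/-- The elastic strain along the bonds in direction `b l` of the projected displacement `v`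
and the projected slip `τ`. -/
noncomputable def strain (τ v : Fin 3 → Site →₀ ℂ) (l : Fin 3) : Site →₀ ℂ :=
  shift (b l) (v l) - v l - τ l

/-- The symbol of the difference in direction `b l`. -/
noncomputable def symb (l : Fin 3) : C(UnitAddTorus (Fin 2), ℂ) := mono (-b l) - 1

theorem hat_strain (τ v : Fin 3 → Site →₀ ℂ) (l : Fin 3) :
    hat (strain τ v l) = symb l * hat (v l) - hat (τ l) := by
  rw [strain, map_sub, map_sub, hat_shift, symb, sub_mul, one_mul]

/-- The incompatibility form of a strain `T` with respect to the symbols `y`. -/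
def incompat (y T : Fin 3 → ℂ) : ℂ := T 0 * (y 1 * y 2) + T 1 * (y 0 * y 2) + T 2 * (y 0 * y 1)

/-- The symbol of the elastic operator. -/
noncomputable def elast (y : Fin 3 → ℂ) : ℝ :=
  ‖y 1‖ ^ 2 * ‖y 2‖ ^ 2 + ‖y 0‖ ^ 2 * ‖y 2‖ ^ 2 + ‖y 0‖ ^ 2 * ‖y 1‖ ^ 2

theorem elast_nonneg (y : Fin 3 → ℂ) : 0 ≤ elast y := by unfold elast; positivity

/-- The minimal energy density at a given frequency. -/
noncomputable def density (y T : Fin 3 → ℂ) : ℝ := ‖incompat y T‖ ^ 2 / elast y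

/-- Cauchy–Schwarz: `elast y` is the squared norm of the coefficient vector of `incompat y`. -/
theorem norm_sq_incompat_le (y T : Fin 3 → ℂ) :
    ‖incompat y T‖ ^ 2 ≤ (∑ l, ‖T l‖ ^ 2) * elast y := by
  have h : ‖incompat y T‖ ≤
      ‖T 0‖ * (‖y 1‖ * ‖y 2‖) + ‖T 1‖ * (‖y 0‖ * ‖y 2‖) + ‖T 2‖ * (‖y 0‖ * ‖y 1‖) := by
    refine (norm_add₃_le).trans ?_
    simp only [norm_mul, le_refl]
  refine (pow_le_pow_left₀ (norm_nonneg _) h 2).trans ?_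
  rw [Fin.sum_univ_three, elast]
  generalize ‖T 0‖ = a
  generalize ‖T 1‖ = b
  generalize ‖T 2‖ = c
  generalize ‖y 0‖ = x
  generalize ‖y 1‖ = z
  generalize ‖y 2‖ = w
  nlinarith [sq_nonneg (a * (x * w) - b * (z * w)), sq_nonneg (a * (x * z) - c * (z * w)),
    sq_nonneg (b * (x * z) - c * (x * w))]

/-- Each `V l` enters with the same coefficient `y 0 * y 1 * y 2`, so the displacement drops out. -/
theorem incompat_strain (y T V : Fin 3 → ℂ) (hV : V 0 + V 1 + V 2 = 0) :
    incompat y (fun l => y l * V l - T l) = -incompat y T := by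
  unfold incompat
  linear_combination (y 0 * y 1 * y 2) * hV

theorem density_le (y T : Fin 3 → ℂ) : density y T ≤ ∑ l, ‖T l‖ ^ 2 :=
  div_le_of_le_mul₀ (elast_nonneg y) (by positivity) (norm_sq_incompat_le y T)

theorem density_le_strain (y T V : Fin 3 → ℂ) (hV : V 0 + V 1 + V 2 = 0) :
    density y T ≤ ∑ l, ‖y l * V l - T l‖ ^ 2 := by
  have := density_le y (fun l => y l * V l - T l)
  rwa [density, incompat_strain y T V hV, norm_neg] at this

theorem density_nonneg (y T : Fin 3 → ℂ) : 0 ≤ density y T :=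
  div_nonneg (by positivity) (elast_nonneg y)

open ComplexConjugate

/-- The numerator of the optimal displacement. -/
noncomputable def optNum (y T : Fin 3 → ℂ) : Fin 3 → ℂ :=
  ![conj (y 0) * (y 1 * conj (y 1) + y 2 * conj (y 2)) * T 0
      - conj (y 1) * (y 2 * conj (y 2)) * T 1 - conj (y 2) * (y 1 * conj (y 1)) * T 2,
    conj (y 1) * (y 0 * conj (y 0) + y 2 * conj (y 2)) * T 1
      - conj (y 0) * (y 2 * conj (y 2)) * T 0 - conj (y 2) * (y 0 * conj (y 0)) * T 2,
    conj (y 2) * (y 0 * conj (y 0) + y 1 * conj (y 1)) * T 2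
      - conj (y 0) * (y 1 * conj (y 1)) * T 0 - conj (y 1) * (y 0 * conj (y 0)) * T 1]

theorem sum_optNum (y T : Fin 3 → ℂ) : optNum y T 0 + optNum y T 1 + optNum y T 2 = 0 := by
  simp only [optNum, Matrix.cons_val]
  ring

theorem elast_eq (y : Fin 3 → ℂ) : (elast y : ℂ) = y 1 * conj (y 1) * (y 2 * conj (y 2)) +
    y 0 * conj (y 0) * (y 2 * conj (y 2)) + y 0 * conj (y 0) * (y 1 * conj (y 1)) := by
  simp only [elast, Complex.mul_conj']
  push_cast; ring

/-- The minimal strain, times the symbol of the elastic operator. -/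
noncomputable def optStrain (y T : Fin 3 → ℂ) : Fin 3 → ℂ :=
  ![conj (y 1 * y 2) * incompat y T, conj (y 0 * y 2) * incompat y T,
    conj (y 0 * y 1) * incompat y T]

/-- `optStrain` is proportional to the conjugate coefficient vector of `incompat y`, the equality
case of Cauchy–Schwarz. So `optNum / elast` is an optimal displacement wherever `elast y ≠ 0`. -/
theorem elast_mul_sub (y T : Fin 3 → ℂ) (l : Fin 3) :
    elast y * T l - y l * optNum y T l = optStrain y T l := by
  rw [elast_eq]
  fin_cases l <;>
  · simp only [optNum, optStrain, incompat, map_mul, Fin.zero_eta, Fin.mk_one, Fin.reduceFinMk,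
      Matrix.cons_val]
    ring

theorem sum_norm_optStrain (y T : Fin 3 → ℂ) :
    ∑ l, ‖optStrain y T l‖ ^ 2 = elast y * ‖incompat y T‖ ^ 2 := by
  simp only [Fin.sum_univ_three, optStrain, Matrix.cons_val, norm_mul, Complex.norm_conj, elast]
  ring

/-- The regularized optimal displacement. -/
noncomputable def optReg (ε : ℝ) (y T : Fin 3 → ℂ) (l : Fin 3) : ℂ :=
  ((elast y / (elast y ^ 2 + ε) : ℝ) : ℂ) * optNum y T l

/-- Replacing 1/elast by elast/(elast² + ε) keeps the displacement continuous at the zeros of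
`elast` when ε > 0. The strain then interpolates between the one of zero displacement and the
optimal one, which yields both a dominating function and the pointwise limit. -/
theorem strain_optReg {y : Fin 3 → ℂ} (hy : elast y ≠ 0) (T : Fin 3 → ℂ) (ε : ℝ) (l : Fin 3) :
    y l * optReg ε y T l - T l =
      -((1 - elast y ^ 2 / (elast y ^ 2 + ε) : ℝ) * T l +
        (elast y ^ 2 / (elast y ^ 2 + ε) : ℝ) * (optStrain y T l / elast y)) := by
  have h := elast_mul_sub y T l
  have hy' : (elast y : ℂ) ≠ 0 := by exact_mod_cast hy
  rw [← h, optReg]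
  push_cast
  field_simp
  ring

theorem sum_strain_optReg_le {y : Fin 3 → ℂ} (hy : elast y ≠ 0) (T : Fin 3 → ℂ) {ε : ℝ}
    (hε : 0 < ε) : ∑ l, ‖y l * optReg ε y T l - T l‖ ^ 2 ≤ 4 * ∑ l, ‖T l‖ ^ 2 := by
  have hpos : 0 < elast y := lt_of_le_of_ne (elast_nonneg y) hy.symm
  have h1 : ∑ l, ‖optStrain y T l / elast y‖ ^ 2 ≤ ∑ l, ‖T l‖ ^ 2 := by
    refine le_trans (le_of_eq ?_) (density_le y T)
    simp_rw [norm_div, div_pow]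
    rw [← Finset.sum_div, sum_norm_optStrain, Complex.norm_real, Real.norm_eq_abs, sq_abs, density]
    field_simp
  have h2 : ∀ l, ‖y l * optReg ε y T l - T l‖ ^ 2 ≤
      2 * ‖T l‖ ^ 2 + 2 * ‖optStrain y T l / elast y‖ ^ 2 := by
    intro l
    rw [strain_optReg hy, norm_neg]
    set s := elast y ^ 2 / (elast y ^ 2 + ε) with hs
    have hs0 : 0 ≤ s := by positivity
    have hs1 : s ≤ 1 := by rw [hs, div_le_one (by positivity)]; linarith
    have h3 : ‖((1 - s : ℝ) : ℂ) * T l + (s : ℂ) * (optStrain y T l / elast y)‖ ≤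
        ‖T l‖ + ‖optStrain y T l / elast y‖ := by
      refine (norm_add_le _ _).trans ?_
      rw [norm_mul, norm_mul, Complex.norm_real, Complex.norm_real, Real.norm_eq_abs,
        Real.norm_eq_abs, abs_of_nonneg hs0, abs_of_nonneg (sub_nonneg.2 hs1)]
      have := norm_nonneg (T l)
      have := norm_nonneg (optStrain y T l / elast y)
      nlinarith
    refine (pow_le_pow_left₀ (norm_nonneg _) h3 2).trans ?_
    nlinarith [sq_nonneg (‖T l‖ - ‖optStrain y T l / elast y‖)]
  refine (Finset.sum_le_sum fun l _ => h2 l).trans ?_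
  rw [Finset.sum_add_distrib, ← Finset.mul_sum, ← Finset.mul_sum]
  linarith

theorem tendsto_sum_strain_optReg {y : Fin 3 → ℂ} (hy : elast y ≠ 0) (T : Fin 3 → ℂ) {ε : ℕ → ℝ}
    (hε : Tendsto ε atTop (𝓝 0)) :
    Tendsto (fun n => ∑ l, ‖y l * optReg (ε n) y T l - T l‖ ^ 2) atTop (𝓝 (density y T)) := by
  have hs : Tendsto (fun n => elast y ^ 2 / (elast y ^ 2 + ε n)) atTop (𝓝 1) := by
    have : Tendsto (fun n => elast y ^ 2 / (elast y ^ 2 + ε n)) atTop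
        (𝓝 (elast y ^ 2 / (elast y ^ 2 + 0))) :=
      tendsto_const_nhds.div (tendsto_const_nhds.add hε) (by simpa using hy)
    rwa [add_zero, div_self (pow_ne_zero 2 hy)] at this
  have e : density y T = ∑ l, ‖-(((1 - 1 : ℝ) : ℂ) * T l + ((1 : ℝ) : ℂ) *
      (optStrain y T l / elast y))‖ ^ 2 := by
    simp only [sub_self, Complex.ofReal_zero, zero_mul, zero_add, Complex.ofReal_one, one_mul,
      norm_neg, norm_div, div_pow]
    rw [← Finset.sum_div, sum_norm_optStrain, Complex.norm_real, Real.norm_eq_abs, sq_abs, density]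
    field_simp
  rw [e]
  refine tendsto_finsetSum _ fun l _ => ?_
  simp_rw [strain_optReg hy]
  have hs' := (Complex.continuous_ofReal.tendsto 1).comp hs
  have hs'' := (Complex.continuous_ofReal.tendsto _).comp (hs.const_sub 1)
  exact (((hs''.mul_const _).add (hs'.mul_const _)).neg.norm.pow 2)

/-- The symbols at a point of the torus. -/
noncomputable def symbs (t : UnitAddTorus (Fin 2)) (l : Fin 3) : ℂ := symb l t

/-- The Fourier transforms of a projected slip at a point of the torus. -/
noncomputable def hats (τ : Fin 3 → Site →₀ ℂ) (t : UnitAddTorus (Fin 2)) (l : Fin 3) : ℂ :=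
  hat (τ l) t

theorem continuous_symbs : Continuous symbs := continuous_pi fun l => (symb l).continuous

theorem continuous_hats (τ : Fin 3 → Site →₀ ℂ) : Continuous (hats τ) :=
  continuous_pi fun l => (hat (τ l)).continuous

theorem continuous_elast : Continuous elast := by unfold elast; fun_prop

theorem continuous_incompat : Continuous fun x : (Fin 3 → ℂ) × (Fin 3 → ℂ) => incompat x.1 x.2 := by
  unfold incompat; fun_prop

theorem continuous_optNum (l : Fin 3) :
    Continuous fun x : (Fin 3 → ℂ) × (Fin 3 → ℂ) => optNum x.1 x.2 l := by
  have hc := Complex.continuous_conj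
  fin_cases l <;>
  · simp only [optNum, Fin.zero_eta, Fin.mk_one, Fin.reduceFinMk, Matrix.cons_val]
    fun_prop

/-- `elast` vanishes only if two of the symbols do; since the bond vectors sum to zero, the third
then vanishes too. But `sin k.1 ≠ 0` makes the symbol of b₁ nonzero. The exceptional set is null. -/
theorem elast_symbs_ne_zero {k : ℝ × ℝ} (hk : Real.sin k.1 ≠ 0) : elast (symbs (torusPt k)) ≠ 0 := by
  intro h
  have h0 : symb 0 (torusPt k) ≠ 0 := by
    intro h0
    apply hk
    rw [symb, ContinuousMap.sub_apply, ContinuousMap.one_apply, sub_eq_zero, mono_torusPt] at h0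
    have e : Complex.I * (k.1 * (2 * ((-b 0).1 : ℤ) - ((-b 0).2 : ℤ)) + k.2 * ((-b 0).2 : ℤ)) =
        -(2 * k.1 * Complex.I) := by simp [b]; ring
    rw [e, Complex.exp_neg, inv_eq_one, Complex.exp_eq_one_iff] at h0
    obtain ⟨n, hn⟩ := h0
    have h1 : (k.1 : ℂ) = n * Real.pi := by
      have := mul_right_cancel₀ Complex.I_ne_zero (hn.trans (by ring :
        (n : ℂ) * (2 * Real.pi * Complex.I) = 2 * (n * Real.pi) * Complex.I))
      linear_combination this / 2
    have h2 : k.1 = n * Real.pi := by exact_mod_cast h1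
    rw [h2]; exact Real.sin_int_mul_pi n
  have hn : 0 < ‖symbs (torusPt k) 0‖ := norm_pos_iff.2 h0
  have e1 : symbs (torusPt k) 1 = 0 := by
    rw [← norm_eq_zero]
    unfold elast at h
    by_contra h1
    have : 0 < ‖symbs (torusPt k) 1‖ := lt_of_le_of_ne (norm_nonneg _) (Ne.symm h1)
    have : 0 < ‖symbs (torusPt k) 0‖ ^ 2 * ‖symbs (torusPt k) 1‖ ^ 2 := by positivity
    nlinarith [sq_nonneg (‖symbs (torusPt k) 0‖ * ‖symbs (torusPt k) 2‖),
      sq_nonneg (‖symbs (torusPt k) 1‖ * ‖symbs (torusPt k) 2‖)]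
  have e2 : symbs (torusPt k) 2 = 0 := by
    rw [← norm_eq_zero]
    unfold elast at h
    by_contra h1
    have : 0 < ‖symbs (torusPt k) 2‖ := lt_of_le_of_ne (norm_nonneg _) (Ne.symm h1)
    have : 0 < ‖symbs (torusPt k) 0‖ ^ 2 * ‖symbs (torusPt k) 2‖ ^ 2 := by positivity
    nlinarith [sq_nonneg (‖symbs (torusPt k) 0‖ * ‖symbs (torusPt k) 1‖),
      sq_nonneg (‖symbs (torusPt k) 1‖ * ‖symbs (torusPt k) 2‖)]
  apply h0
  have e3 : -b 0 + (-b 1 + -b 2) = 0 := by decide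
  have e4 := congrArg (fun f => f (torusPt k)) (congrArg mono e3)
  simp only [mono_add, mono_zero, ContinuousMap.mul_apply, ContinuousMap.one_apply] at e4
  simp only [symbs, symb, ContinuousMap.sub_apply, ContinuousMap.one_apply, sub_eq_zero] at e1 e2 ⊢
  rwa [e1, e2, mul_one, mul_one] at e4

theorem ae_sin_ne_zero : ∀ᵐ p : ℝ, Real.sin p ≠ 0 := by
  have hc : (Set.range fun n : ℤ => (n : ℝ) * Real.pi).Countable := Set.countable_range _
  filter_upwards [hc.ae_notMem volume] with p hp hs
  exact hp (Real.sin_eq_zero_iff.1 hs)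

theorem ae_cell_sin_ne_zero : ∀ᵐ k ∂cell, Real.sin k.1 ≠ 0 :=
  Measure.quasiMeasurePreserving_fst.ae (ae_restrict_of_ae ae_sin_ne_zero)

theorem measurable_density (τ : Fin 3 → Site →₀ ℂ) :
    Measurable fun k => density (symbs (torusPt k)) (hats τ (torusPt k)) := by
  have h1 : Continuous fun k => symbs (torusPt k) := continuous_symbs.comp continuous_torusPt
  have h2 : Continuous fun k => hats τ (torusPt k) := (continuous_hats τ).comp continuous_torusPt
  exact ((continuous_incompat.comp (h1.prodMk h2)).norm.pow 2).measurable.div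
    (continuous_elast.comp h1).measurable

theorem integrable_density (τ : Fin 3 → Site →₀ ℂ) :
    Integrable (fun k => density (symbs (torusPt k)) (hats τ (torusPt k))) cell := by
  refine (integrable_torus (f := fun t => ∑ l, ‖hats τ t l‖ ^ 2) ?_).mono'
    (measurable_density τ).aestronglyMeasurable ?_
  · have := continuous_hats τ
    fun_prop
  · refine Eventually.of_forall fun k => ?_
    rw [Real.norm_eq_abs, abs_of_nonneg (density_nonneg _ _)]
    exact density_le _ _

/-! ### The infimum over finitely supported displacements -/

/-- The infimum of the energy over the finitely supported displacements (without the factor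
`1/2`). -/
noncomputable def minStrain (τ : Fin 3 → Site →₀ ℂ) : ℝ :=
  1 / (2 * Real.pi ^ 2) * ∫ k, density (symbs (torusPt k)) (hats τ (torusPt k)) ∂cell

theorem sum_strain_eq (τ v : Fin 3 → Site →₀ ℂ) :
    ∑ l, (strain τ v l).sum (fun _ z => ‖z‖ ^ 2) =
      1 / (2 * Real.pi ^ 2) * ∑ l, ∫ k, ‖(symb l * hat (v l) - hat (τ l)) (torusPt k)‖ ^ 2 ∂cell := by
  rw [Finset.mul_sum]
  refine Finset.sum_congr rfl fun l _ => ?_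
  rw [← hat_strain, parseval]
  field_simp

theorem minStrain_le (τ v : Fin 3 → Site →₀ ℂ) (hv : v 0 + v 1 + v 2 = 0) :
    minStrain τ ≤ ∑ l, (strain τ v l).sum fun _ z => ‖z‖ ^ 2 := by
  have hi : ∀ l : Fin 3, Integrable
      (fun k => ‖(symb l * hat (v l) - hat (τ l)) (torusPt k)‖ ^ 2) cell := fun l =>
    integrable_torus (f := fun t => ‖(symb l * hat (v l) - hat (τ l)) t‖ ^ 2) (by fun_prop)
  rw [sum_strain_eq, minStrain, ← integral_finsetSum _ fun l _ => hi l]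
  refine mul_le_mul_of_nonneg_left ?_ (by positivity)
  refine integral_mono_ae (integrable_density τ) (integrable_finsetSum _ fun l _ => hi l) ?_
  refine Eventually.of_forall fun k => ?_
  refine density_le_strain _ _ (fun l => hat (v l) (torusPt k)) ?_
  have := congrArg (fun f => hat f (torusPt k)) hv
  simpa only [map_add, map_zero, ContinuousMap.add_apply, ContinuousMap.zero_apply] using this

/-- The regularized optimizers are continuous on the torus and their energies tend to `minStrain τ`
by dominated convergence; a uniformly close trigonometric polynomial is the transform of a finitely
supported displacement. -/
theorem exists_strain_lt (τ : Fin 3 → Site →₀ ℂ) {C : ℝ} (hC : minStrain τ < C) :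
    ∃ v : Fin 3 → Site →₀ ℂ, v 0 + v 1 + v 2 = 0 ∧
      ∑ l, (strain τ v l).sum (fun _ z => ‖z‖ ^ 2) < C := by
  have hy := continuous_symbs
  have hT := continuous_hats τ
  have hε : ∀ n : ℕ, (0 : ℝ) < 1 / ((n : ℝ) + 1) := fun n => Nat.one_div_pos_of_nat
  let V : ℕ → Fin 3 → C(UnitAddTorus (Fin 2), ℂ) := fun n l =>
    ⟨fun t => optReg (1 / ((n : ℝ) + 1)) (symbs t) (hats τ t) l, by
      unfold optReg
      have h1 := continuous_elast.comp hy
      have h2 := (continuous_optNum l).comp (hy.prodMk hT)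
      refine (Complex.continuous_ofReal.comp (h1.div₀ (by fun_prop) fun t => ?_)).mul h2
      have := hε n
      positivity⟩
  have hVsum : ∀ n, V n 0 + V n 1 + V n 2 = 0 := by
    intro n; ext t
    have := sum_optNum (symbs t) (hats τ t)
    simp only [V, ContinuousMap.add_apply, ContinuousMap.coe_mk, ContinuousMap.zero_apply, optReg,
      ← mul_add, this, mul_zero]
  have hi : ∀ (W : Fin 3 → C(UnitAddTorus (Fin 2), ℂ)) (l : Fin 3), Integrable
      (fun k => ‖(symb l * W l - hat (τ l)) (torusPt k)‖ ^ 2) cell := fun W l =>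
    integrable_torus (f := fun t => ‖(symb l * W l - hat (τ l)) t‖ ^ 2) (by fun_prop)
  have hlim : Tendsto (fun n => ∑ l, ∫ k, ‖(symb l * V n l - hat (τ l)) (torusPt k)‖ ^ 2 ∂cell)
      atTop (𝓝 (∫ k, density (symbs (torusPt k)) (hats τ (torusPt k)) ∂cell)) := by
    simp_rw [fun n => (integral_finsetSum Finset.univ fun l _ => hi (V n) l).symm]
    refine tendsto_integral_of_dominated_convergence
      (fun k => 4 * ∑ l, ‖hats τ (torusPt k) l‖ ^ 2) (fun n => ?_) ?_ (fun n => ?_) ?_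
    · exact (integrable_finsetSum _ fun l _ => hi (V n) l).aestronglyMeasurable
    · exact integrable_torus (f := fun t => 4 * ∑ l, ‖hats τ t l‖ ^ 2) (by fun_prop)
    · filter_upwards [ae_cell_sin_ne_zero] with k hk
      rw [Real.norm_eq_abs, abs_of_nonneg (by positivity)]
      exact sum_strain_optReg_le (elast_symbs_ne_zero hk) _ (hε n)
    · filter_upwards [ae_cell_sin_ne_zero] with k hk
      exact tendsto_sum_strain_optReg (elast_symbs_ne_zero hk) _
        tendsto_one_div_add_atTop_nhds_zero_nat
  have hlim' := hlim.const_mul (1 / (2 * Real.pi ^ 2))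
  obtain ⟨n, hn⟩ := (hlim'.eventually_lt_const hC).exists
  -- Only two components are approximated; the third is minus their sum, so the constraint holds
  -- exactly.
  let Ψ : C(UnitAddTorus (Fin 2), ℂ) × C(UnitAddTorus (Fin 2), ℂ) → ℝ := fun W =>
    1 / (2 * Real.pi ^ 2) * (∫ k, ‖(symb 0 * W.1 - hat (τ 0)) (torusPt k)‖ ^ 2 ∂cell +
      ∫ k, ‖(symb 1 * W.2 - hat (τ 1)) (torusPt k)‖ ^ 2 ∂cell +
      ∫ k, ‖(symb 2 * (-W.1 - W.2) - hat (τ 2)) (torusPt k)‖ ^ 2 ∂cell)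
  have hΨ : Continuous Ψ := by
    have h0 := continuous_integral_norm_sq.comp (f := fun W : C(UnitAddTorus (Fin 2), ℂ) ×
      C(UnitAddTorus (Fin 2), ℂ) => symb 0 * W.1 - hat (τ 0)) (by fun_prop)
    have h1 := continuous_integral_norm_sq.comp (f := fun W : C(UnitAddTorus (Fin 2), ℂ) ×
      C(UnitAddTorus (Fin 2), ℂ) => symb 1 * W.2 - hat (τ 1)) (by fun_prop)
    have h2 := continuous_integral_norm_sq.comp (f := fun W : C(UnitAddTorus (Fin 2), ℂ) ×
      C(UnitAddTorus (Fin 2), ℂ) => symb 2 * (-W.1 - W.2) - hat (τ 2)) (by fun_prop)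
    exact continuous_const.mul ((h0.add h1).add h2)
  have hV2 : V n 2 = -V n 0 - V n 1 := by
    rw [sub_eq_add_neg, ← neg_add, eq_neg_iff_add_eq_zero, add_comm, hVsum n]
  obtain ⟨w, hw⟩ := (denseRange_hat.prodMap denseRange_hat).exists_mem_open
    (isOpen_lt hΨ (continuous_const (y := C))) ⟨(V n 0, V n 1), by
      rw [Fin.sum_univ_three, hV2] at hn
      exact hn⟩
  refine ⟨![w.1, w.2, -w.1 - w.2], by simp only [Matrix.cons_val]; abel, ?_⟩
  rw [sum_strain_eq, Fin.sum_univ_three]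
  simp only [Matrix.cons_val, map_sub, map_neg]
  exact hw

/-! ### The slip of an elementary dipole -/

/-- The slip field of an elementary dipole: the bonds from `b₁` to the row above slip by `b₁`. -/
def slip₀ (x y : Site) : Site :=
  if x = (1, 0) ∧ (y = (1, 1) ∨ y = (2, 1)) then b 0
  else if y = (1, 0) ∧ (x = (1, 1) ∨ x = (2, 1)) then -b 0 else 0

theorem slip₀_odd (x y : Site) : slip₀ y x = -slip₀ x y := by
  unfold slip₀
  obtain ⟨a, c⟩ := x
  obtain ⟨a', c'⟩ := y
  simp only [Prod.mk.injEq]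
  split_ifs <;> first | rfl | (exfalso; omega)

theorem adj_iff {a c a' c' : ℤ} : Adj (a, c) (a', c') ↔
    (a' = a + 1 ∧ c' = c) ∨ (a' = a - 1 ∧ c' = c) ∨ (a' = a ∧ c' = c + 1) ∨ (a' = a ∧ c' = c - 1) ∨
    (a' = a - 1 ∧ c' = c - 1) ∨ (a' = a + 1 ∧ c' = c + 1) := by
  simp only [Adj, b, Fin.exists_fin_succ, Prod.ext_iff, Prod.fst_add, Prod.snd_add]
  simp
  omega

/-- Two 2-forms which agree on the upward and the downward faces agree. -/
theorem eq_on_faces {f g : Site → Site → Site → Site}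
    (hf : ∀ x y z, f y z x = f x y z) (hf' : ∀ x y z, f x z y = -f x y z)
    (hg : ∀ x y z, g y z x = g x y z) (hg' : ∀ x y z, g x z y = -g x y z)
    (h1 : ∀ a c, f (a, c) (a + 1, c) (a + 1, c + 1) = g (a, c) (a + 1, c) (a + 1, c + 1))
    (h2 : ∀ a c, f (a, c) (a, c + 1) (a + 1, c + 1) = g (a, c) (a, c + 1) (a + 1, c + 1))
    {x y z : Site} (hxy : Adj x y) (hyz : Adj y z) (hzx : Adj z x) : f x y z = g x y z := by
  have rot : ∀ {x y z}, f x y z = g x y z → f y z x = g y z x := fun h => by rw [hf, hg, h]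
  have rot' : ∀ {x y z}, f x y z = g x y z → f z x y = g z x y := fun h => rot (rot h)
  have flip : ∀ {x y z}, f x y z = g x y z → f x z y = g x z y := fun h => by rw [hf', hg', h]
  obtain ⟨a, c⟩ := x
  obtain ⟨a', c'⟩ := y
  obtain ⟨a'', c''⟩ := z
  rw [adj_iff] at hxy hyz hzx
  rcases hxy with ⟨rfl, rfl⟩ | ⟨rfl, rfl⟩ | ⟨rfl, rfl⟩ | ⟨rfl, rfl⟩ | ⟨rfl, rfl⟩ | ⟨rfl, rfl⟩
  · have : (a'' = a + 1 ∧ c'' = c' + 1) ∨ (a'' = a ∧ c'' = c' - 1) := by omega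
    rcases this with ⟨rfl, rfl⟩ | ⟨rfl, rfl⟩
    · exact h1 _ _
    · have := rot (h2 a'' (c' - 1))
      simpa using this
  · have : (a'' = a ∧ c'' = c' + 1) ∨ (a'' = a - 1 ∧ c'' = c' - 1) := by omega
    rcases this with ⟨rfl, rfl⟩ | ⟨rfl, rfl⟩
    · have := rot (flip (rot (rot (h1 (a'' - 1) c'))))
      simpa using this
    · have := flip (rot' (h2 (a - 1) (c' - 1)))
      simpa using this
  · have : (a'' = a' + 1 ∧ c'' = c + 1) ∨ (a'' = a' - 1 ∧ c'' = c) := by omega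
    rcases this with ⟨rfl, rfl⟩ | ⟨rfl, rfl⟩
    · exact h2 _ _
    · have := rot (h1 (a' - 1) c'')
      simpa using this
  · have : (a'' = a' + 1 ∧ c'' = c) ∨ (a'' = a' - 1 ∧ c'' = c - 1) := by omega
    rcases this with ⟨rfl, rfl⟩ | ⟨rfl, rfl⟩
    · have := rot (rot (flip (h2 a' (c'' - 1))))
      simpa using this
    · have := flip (rot' (h1 (a' - 1) (c - 1)))
      simpa using this
  · have : (a'' = a - 1 ∧ c'' = c) ∨ (a'' = a ∧ c'' = c - 1) := by omega
    rcases this with ⟨rfl, rfl⟩ | ⟨rfl, rfl⟩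
    · have := rot' (h2 (a - 1) (c'' - 1))
      simpa using this
    · have := rot' (h1 (a'' - 1) (c - 1))
      simpa using this
  · have : (a'' = a ∧ c'' = c + 1) ∨ (a'' = a + 1 ∧ c'' = c) := by omega
    rcases this with ⟨rfl, rfl⟩ | ⟨rfl, rfl⟩
    · exact flip (h2 _ _)
    · exact flip (h1 _ _)

theorem faceInd_rot (v₁ v₂ v₃ x y z : Site) : faceInd v₁ v₂ v₃ y z x = faceInd v₁ v₂ v₃ x y z := by
  unfold faceInd
  simp only [Prod.mk.injEq]
  congr 1
  · apply propext; tauto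
  · congr 1
    apply propext; tauto

theorem faceInd_up (v₁ v₂ a c : ℤ) :
    faceInd (v₁, v₂) (v₁ + 1, v₂) (v₁ + 1, v₂ + 1) (a, c) (a + 1, c) (a + 1, c + 1) =
      if a = v₁ ∧ c = v₂ then 1 else 0 := by
  unfold faceInd
  simp only [Prod.mk.injEq]
  split_ifs <;> first | rfl | (exfalso; omega)

theorem faceInd_down (v₁ v₂ a c : ℤ) :
    faceInd (v₁, v₂) (v₁ + 1, v₂) (v₁ + 1, v₂ + 1) (a, c) (a, c + 1) (a + 1, c + 1) = 0 := by
  unfold faceInd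
  simp only [Prod.mk.injEq]
  split_ifs <;> first | rfl | (exfalso; omega)

theorem faceInd_flip {v₁ v₂ v₃ : Site} (h1 : v₁ ≠ v₂) (h2 : v₂ ≠ v₃) (h3 : v₁ ≠ v₃) (x y z : Site) :
    faceInd v₁ v₂ v₃ x z y = -faceInd v₁ v₂ v₃ x y z := by
  unfold faceInd
  simp only [Prod.mk.injEq]
  split_ifs <;> grind

/-- The two slipping bonds bound a common downward face, where their contributions cancel. The
upward faces on their other sides are `f_0` and `f_1`, which get b₁ and -b₁. -/
theorem hasCharge_slip₀ : HasCharge slip₀ (qDip 1) := by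
  intro x y z
  refine eq_on_faces ?_ ?_ ?_ ?_ ?_ ?_
  · intro x y z; simp only [d]; abel
  · intro x y z
    simp only [d]
    rw [slip₀_odd z x, slip₀_odd y z, slip₀_odd x y]; abel
  · intro x y z; simp only [qDip, faceInd_rot]
  · intro x y z
    simp only [qDip]
    rw [faceInd_flip (v₁ := 0) (by decide) (by decide) (by decide),
      faceInd_flip (v₁ := 1 • b 0) (by decide) (by decide) (by decide)]
    module
  · intro a c
    have e1 : (0 : Site) = (0, 0) := rfl
    have := faceInd_up 0 0 a c
    have := faceInd_up 1 0 a c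
    simp_all [d, qDip, slip₀, b]
    split_ifs <;> first | (exfalso; omega) | rfl
  · intro a c
    have e1 : (0 : Site) = (0, 0) := rfl
    have := faceInd_down 0 0 a c
    have := faceInd_down 1 0 a c
    simp_all [d, qDip, slip₀, b]
    split_ifs <;> first | (exfalso; omega) | rfl


/-! ### Convergence of the minima as the box grows -/

theorem strain_support_subset {Λ : Finset Site} {τ v : Fin 3 → Site →₀ ℂ} (l : Fin 3)
    (hv : ∀ x, x ∉ Λ → v l x = 0) (hτ : ∀ x, x ∉ Λ → x + b l ∉ Λ → τ l x = 0) :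
    (strain τ v l).support ⊆ Λ ∪ Λ.image (fun y => y - b l) := by
  intro x hx
  rw [Finsupp.mem_support_iff] at hx
  by_contra h
  rw [Finset.mem_union, not_or, Finset.mem_image] at h
  have h2 : x + b l ∉ Λ := fun h' => h.2 ⟨_, h', add_sub_cancel_right _ _⟩
  apply hx
  simp only [strain, Finsupp.sub_apply, shift_apply, hv _ h.1, hv _ h2, hτ _ h.1 h2, sub_zero]

set_option linter.unnecessarySeqFocus false in
theorem inner_pos_b (a : ℝ) (c : ℝ) (l : Fin 3) :
    inner ℝ (!₂[a, c] : EuclideanSpace ℝ (Fin 2)) (pos (b l)) =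
      ![a, -(1 / 2) * a + √3 / 2 * c, -(1 / 2) * a - √3 / 2 * c] l := by
  fin_cases l <;> simp [PiLp.inner_apply, pos, b] <;> ring

theorem sum_b : b 0 + b 1 + b 2 = 0 := by decide

/-- Each box minimizer is a finitely supported competitor, which gives the lower bound; conversely a
nearly optimal competitor fits into all large boxes. -/
theorem isLimMinEnergy_of_slip {σ : Site → Site → Site} {q : Site → Site → Site → Site}
    (hodd : ∀ x y, σ y x = -σ x y) (K : Finset Site) (hK : ∀ x, x ∉ K → ∀ y, σ x y = 0)
    (hq : HasCharge σ q) {τ : Fin 3 → Site →₀ ℂ}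
    (hτ : ∀ l x, τ l x = ((inner ℝ (pos (σ x (x + b l))) (pos (b l)) : ℝ) : ℂ)) :
    IsLimMinEnergy q (1 / 2 * minStrain τ) := by
  have hslip : ∀ {N}, K ⊆ box N → IsSlipField (box N) σ := fun h =>
    ⟨fun x y _ => hodd x y, fun x y _ hx _ => hK x (fun h' => hx (h h')) y⟩
  have hτ0 : ∀ {N}, K ⊆ box N → ∀ l x, x ∉ box N → x + b l ∉ box N → τ l x = 0 := by
    intro N h l x hx _
    rw [hτ, hK x (fun h' => hx (h h')), pos_zero, inner_zero_left, Complex.ofReal_zero]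
  -- Boxes too small to contain the slip receive the irrelevant value 0.
  have hex : ∀ N, ∃ e, K ⊆ box N → IsLeast (energies N q) e := by
    intro N
    by_cases h : K ⊆ box N
    · obtain ⟨e, he⟩ := exists_isLeast_energies (hslip h) hq
      exact ⟨e, fun _ => he⟩
    · exact ⟨0, fun h' => absurd h' h⟩
  choose e he using hex
  have hlow : ∀ N, K ⊆ box N → 1 / 2 * minStrain τ ≤ e N := by
    intro N hN
    obtain ⟨u, hu, hue⟩ := (mem_energies_iff (hslip hN) hq _).1 (he N hN).1
    let v : Fin 3 → Site →₀ ℂ := fun l => Finsupp.onFinset (box N)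
      (fun x => ((inner ℝ (u x) (pos (b l)) : ℝ) : ℂ)) (fun x hx => by
        by_contra h
        rw [hu x h, inner_zero_left] at hx
        exact hx rfl)
    have hv : v 0 + v 1 + v 2 = 0 := by
      ext x
      simp only [v, Finsupp.add_apply, Finsupp.onFinset_apply, Finsupp.zero_apply]
      rw [← Complex.ofReal_add, ← Complex.ofReal_add, ← inner_add_right, ← inner_add_right,
        ← pos_add, ← pos_add, sum_b, pos_zero, inner_zero_right, Complex.ofReal_zero]
    rw [← hue, energy]
    refine mul_le_mul_of_nonneg_left ((minStrain_le τ v hv).trans (le_of_eq ?_)) (by norm_num)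
    refine Finset.sum_congr rfl fun l _ => ?_
    rw [Finsupp.sum_of_support_subset _ (strain_support_subset (Λ := box N) l (fun x hx => ?_)
      (hτ0 hN l)) _ (by simp)]
    · refine Finset.sum_congr rfl fun x _ => ?_
      simp only [strain, Finsupp.sub_apply, shift_apply, v, Finsupp.onFinset_apply, hτ]
      rw [← Complex.ofReal_sub, ← Complex.ofReal_sub, Complex.norm_real, Real.norm_eq_abs, sq_abs,
        ← inner_sub_left, ← inner_sub_left]
    · simp only [v, Finsupp.onFinset_apply, hu x hx, inner_zero_left, Complex.ofReal_zero]
  have hup : ∀ C, 1 / 2 * minStrain τ < C → ∀ᶠ N in atTop, e N < C := by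
    intro C hC
    obtain ⟨v, hv, hvC⟩ := exists_strain_lt τ (C := 2 * C) (by linarith)
    filter_upwards [eventually_subset_box K, eventually_subset_box (v 0).support,
      eventually_subset_box (v 1).support] with N hN h0 h1
    -- The vector whose projections on b₁ and b₂ are the real parts of `v 0 x` and `v 1 x`; the
    -- projection on b₃ follows from the zero sum.
    let u : Site → EuclideanSpace ℝ (Fin 2) := fun x =>
      !₂[(v 0 x).re, (2 * (v 1 x).re + (v 0 x).re) / √3]
    have hv2 : ∀ x, v 2 x = -v 0 x - v 1 x := by
      intro x
      have := DFunLike.congr_fun hv x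
      simp only [Finsupp.add_apply, Finsupp.zero_apply] at this
      linear_combination this
    have hv0 : ∀ l x, x ∉ box N → v l x = 0 := by
      intro l x hx
      have e0 : v 0 x = 0 := Finsupp.notMem_support_iff.1 fun h => hx (h0 h)
      have e1 : v 1 x = 0 := Finsupp.notMem_support_iff.1 fun h => hx (h1 h)
      fin_cases l
      · exact e0
      · exact e1
      · simpa [e0, e1] using hv2 x
    have hu : IsDisplacement (box N) u := by
      intro x hx
      simp only [u, hv0 _ x hx]
      ext i; fin_cases i <;> simp
    have hinner : ∀ l x, inner ℝ (u x) (pos (b l)) = (v l x).re := by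
      intro l x
      have h3 : √3 ≠ 0 := by positivity
      simp only [u]
      rw [inner_pos_b]
      fin_cases l
      · rfl
      · simp only [Fin.mk_one, Matrix.cons_val]
        field_simp
        ring
      · simp only [Fin.reduceFinMk, Matrix.cons_val, hv2 x, Complex.sub_re, Complex.neg_re]
        field_simp
        ring
    refine lt_of_le_of_lt ((he N hN).2 ((mem_energies_iff (hslip hN) hq _).2 ⟨u, hu, rfl⟩)) ?_
    -- Since the projected slip is real, passing to real parts cannot increase the energy.
    have : energy (box N) u σ ≤ 1 / 2 * ∑ l, (strain τ v l).sum (fun _ z => ‖z‖ ^ 2) := by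
      rw [energy]
      refine mul_le_mul_of_nonneg_left (Finset.sum_le_sum fun l _ => ?_) (by norm_num)
      rw [Finsupp.sum_of_support_subset _ (strain_support_subset (Λ := box N) l (hv0 l)
        (hτ0 hN l)) _ (by simp)]
      refine Finset.sum_le_sum fun x _ => ?_
      have : inner ℝ (u (x + b l) - u x - pos (σ x (x + b l))) (pos (b l)) =
          (strain τ v l x).re := by
        simp only [strain, Finsupp.sub_apply, shift_apply, hτ, inner_sub_left, hinner,
          Complex.sub_re, Complex.ofReal_re]
      rw [this, ← sq_abs]
      exact pow_le_pow_left₀ (abs_nonneg _) (Complex.abs_re_le_norm _) 2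
    linarith
  refine ⟨e, (eventually_subset_box K).mono he, ?_⟩
  rw [tendsto_order]
  exact ⟨fun a ha => (eventually_subset_box K).mono fun N hN => ha.trans_le (hlow N hN), hup⟩

/-! ### Energy densities of dipoles and walls -/

/-- The projection of the elementary slip on the bonds. -/
noncomputable def τ₀ : Fin 3 → Site →₀ ℂ :=
  ![0, Finsupp.single (1, 0) (-(1 / 2)), Finsupp.single (2, 1) (1 / 2)]

theorem τ₀_apply (l : Fin 3) (x : Site) :
    τ₀ l x = ((inner ℝ (pos (slip₀ x (x + b l))) (pos (b l)) : ℝ) : ℂ) := by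
  have hb : pos (b 0) = !₂[1, 0] := by ext i; fin_cases i <;> simp [pos, b]
  have hb' : pos (-b 0) = !₂[-1, 0] := by ext i; fin_cases i <;> simp [pos, b]
  obtain ⟨a, c⟩ := x
  have e1 : (0 : Site) = (0, 0) := rfl
  have hn : (!₂[(-1 : ℝ), 0] : EuclideanSpace ℝ (Fin 2)) = -!₂[1, 0] := by
    ext i; fin_cases i <;> simp
  unfold slip₀
  fin_cases l
  · rw [if_neg, if_neg]
    · simp [τ₀, pos_zero]
    · simp [b]; omega
    · simp [b]; omega
  · rw [if_neg (c := _ = _ ∧ ((a, c) = _ ∨ _)) (by simp [b]; omega)]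
    by_cases h : (a, c) = (1, 0)
    · rw [h, if_pos (by simp [b]), hb, inner_pos_b]
      simp [τ₀]
    · rw [if_neg fun h' => h h'.1]
      simp only [τ₀, Fin.mk_one, Matrix.cons_val, pos_zero, inner_zero_left, Complex.ofReal_zero]
      exact Finsupp.single_eq_of_ne h
  · rw [if_neg (by simp [b]; omega)]
    by_cases h : (a, c) = (2, 1)
    · rw [h, if_pos (by simp [b]), hb', inner_pos_b]
      simp [τ₀]
    · rw [if_neg]
      · simp only [τ₀, Fin.reduceFinMk, Matrix.cons_val, pos_zero, inner_zero_left,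
          Complex.ofReal_zero]
        exact Finsupp.single_eq_of_ne h
      · simp only [Prod.mk.injEq] at h
        simp [b]; omega

/-- The energy density at `(p, d)` of an infinite wall of alternating slips. -/
noncomputable def profile (p d : ℝ) : ℝ :=
  (1 - 2 * Real.cos p * Real.cos d + Real.cos p ^ 2) /
    ((Real.cos d - Real.cos p) ^ 2 + 4 * (1 - Real.cos p ^ 2) * (1 - Real.cos p * Real.cos d))

theorem norm_exp_sub_one_sq (θ : ℝ) : ‖Complex.exp (θ * Complex.I) - 1‖ ^ 2 = 2 - 2 * Real.cos θ := by
  rw [Complex.sq_norm, Complex.normSq_apply]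
  simp only [Complex.sub_re, Complex.sub_im, Complex.exp_ofReal_mul_I_re,
    Complex.exp_ofReal_mul_I_im, Complex.one_re, Complex.one_im]
  nlinarith [Real.sin_sq_add_cos_sq θ]

theorem norm_symb_sq (k : ℝ × ℝ) (l : Fin 3) : ‖symbs (torusPt k) l‖ ^ 2 =
    ![2 - 2 * Real.cos (2 * k.1), 2 - 2 * Real.cos (k.2 - k.1), 2 - 2 * Real.cos (k.2 + k.1)] l := by
  simp only [symbs, symb, ContinuousMap.sub_apply, ContinuousMap.one_apply, mono_torusPt]
  fin_cases l
  · simp only [Matrix.cons_val, Fin.zero_eta]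
    rw [← Real.cos_neg, ← norm_exp_sub_one_sq]
    congr 4
    simp [b]; ring
  · simp only [Matrix.cons_val, Fin.mk_one]
    rw [← Real.cos_neg, ← norm_exp_sub_one_sq]
    congr 4
    simp [b]; ring
  · simp only [Matrix.cons_val, Fin.reduceFinMk]
    rw [← norm_exp_sub_one_sq]
    congr 4
    simp [b]; ring

/-- The form factors as the symbol of b₁, of squared modulus 4 sin²p, times a phase times cos p -
exp(id). -/
theorem norm_incompat_τ₀ (k : ℝ × ℝ) :
    ‖incompat (symbs (torusPt k)) (hats τ₀ (torusPt k))‖ ^ 2 =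
      4 * Real.sin k.1 ^ 2 * (1 - 2 * Real.cos k.1 * Real.cos k.2 + Real.cos k.1 ^ 2) := by
  have h0 : hats τ₀ (torusPt k) 0 = 0 := by simp [hats, τ₀]
  have h1 : hats τ₀ (torusPt k) 1 = -(1 / 2) * mono (1, 0) (torusPt k) := by
    simp [hats, τ₀, hat, Finsupp.linearCombination_single]
  have h2 : hats τ₀ (torusPt k) 2 = 1 / 2 * mono (2, 1) (torusPt k) := by
    simp [hats, τ₀, hat, Finsupp.linearCombination_single]
  have e : incompat (symbs (torusPt k)) (hats τ₀ (torusPt k)) = symbs (torusPt k) 0 *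
      (Complex.exp ((3 * k.1 : ℝ) * Complex.I) *
        ((Real.cos k.1 - Real.cos k.2 : ℝ) + (-Real.sin k.2 : ℝ) * Complex.I)) := by
    rw [incompat, h0, h1, h2]
    have e1 : -(1 / 2) * mono (1, 0) (torusPt k) * symbs (torusPt k) 2 +
        1 / 2 * mono (2, 1) (torusPt k) * symbs (torusPt k) 1 =
        Complex.exp ((3 * k.1 : ℝ) * Complex.I) *
        ((Real.cos k.1 - Real.cos k.2 : ℝ) + (-Real.sin k.2 : ℝ) * Complex.I) := by
      have m1 : mono (1, 0) (torusPt k) * mono (-b 2) (torusPt k) = mono (2, 1) (torusPt k) := by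
        rw [← ContinuousMap.mul_apply, ← mono_add]; rfl
      have m2 : mono (2, 1) (torusPt k) * mono (-b 1) (torusPt k) = mono (2, 0) (torusPt k) := by
        rw [← ContinuousMap.mul_apply, ← mono_add]; rfl
      have e2 : ((Real.cos k.1 - Real.cos k.2 : ℝ) : ℂ) + (-Real.sin k.2 : ℝ) * Complex.I =
          (Complex.exp (k.1 * Complex.I) + Complex.exp (-k.1 * Complex.I)) / 2 -
            Complex.exp (k.2 * Complex.I) := by
        push_cast
        rw [Complex.exp_mul_I k.2, Complex.cos]
        ring
      rw [e2, mul_sub, mul_div_assoc', mul_add, ← Complex.exp_add, ← Complex.exp_add,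
        ← Complex.exp_add]
      simp only [symbs, symb, ContinuousMap.sub_apply, ContinuousMap.one_apply]
      have m3 : mono (2, 0) (torusPt k) = Complex.exp ((3 * k.1 : ℝ) * Complex.I + k.1 * Complex.I) := by
        rw [mono_torusPt]; congr 1; push_cast; ring
      have m4 : mono (1, 0) (torusPt k) = Complex.exp ((3 * k.1 : ℝ) * Complex.I + -k.1 * Complex.I) := by
        rw [mono_torusPt]; congr 1; push_cast; ring
      have m5 : mono (2, 1) (torusPt k) = Complex.exp ((3 * k.1 : ℝ) * Complex.I + k.2 * Complex.I) := by
        rw [mono_torusPt]; congr 1; push_cast; ring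
      rw [← m3, ← m4, ← m5]
      linear_combination (-1 / 2) * m1 + (1 / 2) * m2
    linear_combination symbs (torusPt k) 0 * e1
  rw [e, norm_mul, norm_mul, Complex.norm_exp_ofReal_mul_I, one_mul, mul_pow, norm_symb_sq,
    Complex.sq_norm, Complex.normSq_add_mul_I]
  simp only [Matrix.cons_val]
  rw [Real.cos_two_mul, Real.sin_sq]
  nlinarith [Real.sin_sq_add_cos_sq k.2]

theorem elast_torusPt (k : ℝ × ℝ) : elast (symbs (torusPt k)) =
    4 * ((Real.cos k.2 - Real.cos k.1) ^ 2 +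
      4 * (1 - Real.cos k.1 ^ 2) * (1 - Real.cos k.1 * Real.cos k.2)) := by
  simp only [elast, norm_symb_sq, Matrix.cons_val]
  rw [Real.cos_two_mul, Real.cos_sub, Real.cos_add]
  have h1 : Real.sin k.1 ^ 2 = 1 - Real.cos k.1 ^ 2 := Real.sin_sq _
  have h2 : Real.sin k.2 ^ 2 = 1 - Real.cos k.2 ^ 2 := Real.sin_sq _
  linear_combination (-4 * Real.sin k.2 ^ 2) * h1 - (4 * (1 - Real.cos k.1 ^ 2)) * h2

theorem density_τ₀ (k : ℝ × ℝ) : density (symbs (torusPt k)) (hats τ₀ (torusPt k)) =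
    Real.sin k.1 ^ 2 * profile k.1 k.2 := by
  rw [density, norm_incompat_τ₀, elast_torusPt, profile, mul_assoc, mul_div_mul_left _ _ (by norm_num),
    mul_div_assoc]

theorem density_smul (y T : Fin 3 → ℂ) (c : ℂ) :
    density y (fun l => c * T l) = ‖c‖ ^ 2 * density y T := by
  have : incompat y (fun l => c * T l) = c * incompat y T := by unfold incompat; ring
  rw [density, this, norm_mul, mul_pow, mul_div_assoc, density]

theorem adj_sub {x y : Site} (h : Adj x y) (t : Site) : Adj (x - t) (y - t) := by
  obtain ⟨l, rfl | rfl⟩ := h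
  exacts [⟨l, Or.inl (by abel)⟩, ⟨l, Or.inr (by abel)⟩]

/-- Translating a slip multiplies its transform by a character, and the density is quadratic in the
slip. The prefactor is 1/2 of the energy times 1/(2π²) of Parseval. -/
theorem isLimMinEnergy_sum_translates {ι : Type*} (s : Finset ι) (t : ι → Site) :
    IsLimMinEnergy (fun x y z => ∑ i ∈ s, qDip 1 (x - t i) (y - t i) (z - t i))
      (1 / (4 * Real.pi ^ 2) * ∫ k, ‖∑ i ∈ s, mono (t i) (torusPt k)‖ ^ 2 *
        (Real.sin k.1 ^ 2 * profile k.1 k.2) ∂cell) := by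
  let σ : Site → Site → Site := fun x y => ∑ i ∈ s, slip₀ (x - t i) (y - t i)
  let τ : Fin 3 → Site →₀ ℂ := fun l => ∑ i ∈ s, shift (-t i) (τ₀ l)
  have h := isLimMinEnergy_of_slip (σ := σ) (τ := τ)
    (q := fun x y z => ∑ i ∈ s, qDip 1 (x - t i) (y - t i) (z - t i))
    (fun x y => by
      simp only [σ, ← Finset.sum_neg_distrib]
      exact Finset.sum_congr rfl fun i _ => slip₀_odd _ _)
    (s.biUnion fun i => {(1, 0) + t i, (1, 1) + t i, (2, 1) + t i})
    (by
      intro x hx y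
      refine Finset.sum_eq_zero fun i hi => ?_
      have hx' : x ∉ ({(1, 0) + t i, (1, 1) + t i, (2, 1) + t i} : Finset Site) := fun h =>
        hx (Finset.mem_biUnion.2 ⟨i, hi, h⟩)
      simp only [Finset.mem_insert, Finset.mem_singleton, not_or, ← sub_eq_iff_eq_add] at hx'
      simp [slip₀, hx'])
    (by
      intro x y z h1 h2 h3
      simp only [d, σ, ← Finset.sum_add_distrib]
      refine Finset.sum_congr rfl fun i _ => ?_
      exact hasCharge_slip₀ _ _ _ (adj_sub h1 _) (adj_sub h2 _) (adj_sub h3 _))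
    (by
      intro l x
      have : pos (σ x (x + b l)) = ∑ i ∈ s, pos (slip₀ (x - t i) (x + b l - t i)) :=
        map_sum (AddMonoidHom.mk' pos pos_add) _ _
      rw [this, sum_inner, Complex.ofReal_sum, Finsupp.finsetSum_apply]
      refine Finset.sum_congr rfl fun i _ => ?_
      rw [shift_apply, τ₀_apply, ← sub_eq_add_neg, sub_add_eq_add_sub])
  convert h using 1
  rw [minStrain, ← mul_assoc]
  congr 1
  · ring
  · congr 1
    ext k
    have : hats τ (torusPt k) = fun l => (∑ i ∈ s, mono (t i) (torusPt k)) * hats τ₀ (torusPt k) l := by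
      ext l
      simp only [hats, τ, map_sum, hat_shift, neg_neg, ContinuousMap.sum_apply,
        ContinuousMap.mul_apply, Finset.sum_mul]
    rw [this, density_smul, density_τ₀]

theorem faceInd_translate (v₁ v₂ v₃ t x y z : Site) :
    faceInd (v₁ + t) (v₂ + t) (v₃ + t) x y z = faceInd v₁ v₂ v₃ (x - t) (y - t) (z - t) := by
  unfold faceInd
  simp only [Prod.mk.injEq (α := Site) (β := Site × Site), Prod.mk.injEq (α := Site) (β := Site),
    sub_eq_iff_eq_add]

/-- Telescoping: adjacent elementary dipoles cancel at their common face. -/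
theorem qDip_eq_sum (n : ℕ) (x y z : Site) :
    qDip n x y z = ∑ i ∈ Finset.range n, qDip 1 (x - i • b 0) (y - i • b 0) (z - i • b 0) := by
  have h : ∀ i : ℕ, qDip 1 (x - i • b 0) (y - i • b 0) (z - i • b 0) =
      faceInd (i • b 0) (b 0 + i • b 0) (-b 2 + i • b 0) x y z • b 0 -
      faceInd ((i + 1) • b 0) (b 0 + (i + 1) • b 0) (-b 2 + (i + 1) • b 0) x y z • b 0 := by
    intro i
    rw [qDip, ← faceInd_translate, ← faceInd_translate, sub_smul, zero_add, one_smul, add_assoc,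
      add_assoc, succ_nsmul']
  simp_rw [h]
  rw [Finset.sum_range_sub' (fun i => faceInd (i • b 0) (b 0 + i • b 0) (-b 2 + i • b 0) x y z • b 0),
    qDip, zero_smul, add_zero, add_zero, sub_smul]

/-- Geometric sum, with |exp(2iθ) - 1|² = 4 sin²θ. -/
theorem norm_sum_exp_sq_mul_sin_sq (n : ℕ) (p : ℝ) :
    ‖∑ i ∈ Finset.range n, Complex.exp ((2 * p : ℝ) * Complex.I) ^ i‖ ^ 2 * Real.sin p ^ 2 =
      Real.sin (n * p) ^ 2 := by
  have h := mul_geom_sum (Complex.exp ((2 * p : ℝ) * Complex.I)) n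
  rw [← Complex.exp_nat_mul, show (n : ℂ) * ((2 * p : ℝ) * Complex.I) =
    ((2 * (n * p) : ℝ) : ℂ) * Complex.I by push_cast; ring] at h
  have h2 := congrArg (fun z => ‖z‖ ^ 2) h
  simp only [norm_mul, mul_pow, norm_exp_sub_one_sq] at h2
  rw [Real.cos_two_mul, Real.cos_two_mul] at h2
  rw [Real.sin_sq, Real.sin_sq]
  linarith

theorem mono_nsmul (j : ℕ) (x : Site) (t) : mono (j • x) t = mono x t ^ j := by
  induction j with
  | zero => rw [zero_smul, mono_zero, pow_zero]; rfl
  | succ j ih => rw [succ_nsmul, mono_add, ContinuousMap.mul_apply, ih, pow_succ]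

theorem mono_b0 (k : ℝ × ℝ) : mono (b 0) (torusPt k) = Complex.exp ((2 * k.1 : ℝ) * Complex.I) := by
  rw [mono_torusPt]; congr 1; simp [b]; ring

theorem isLimMinEnergy_qDip (n : ℕ) : IsLimMinEnergy (qDip n) (1 / (4 * Real.pi ^ 2) *
    ∫ k, Real.sin (n * k.1) ^ 2 * profile k.1 k.2 ∂cell) := by
  have h := isLimMinEnergy_sum_translates (Finset.range n) (fun i => i • b 0)
  convert h using 1
  · ext x y z : 3; exact qDip_eq_sum n x y z
  · congr 2
    ext k
    simp_rw [mono_nsmul, mono_b0]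
    rw [← mul_assoc, norm_sum_exp_sq_mul_sin_sq]

theorem isLimMinEnergy_qGrain (M n m : ℕ) : IsLimMinEnergy (qGrain M n m) (1 / (4 * Real.pi ^ 2) *
    ∫ k, ‖∑ j ∈ Finset.Icc 1 M, Complex.exp ((2 * m * k.2 : ℝ) * Complex.I) ^ j‖ ^ 2 *
      (Real.sin (n * k.1) ^ 2 * profile k.1 k.2) ∂cell) := by
  have h := isLimMinEnergy_sum_translates (Finset.Icc 1 M ×ˢ Finset.range n)
    (fun i => (i.1 * m) • (b 1 - b 2) + i.2 • b 0)
  convert h using 1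
  · ext x y z : 3
    rw [qGrain, Finset.sum_product]
    refine Finset.sum_congr rfl fun j _ => ?_
    rw [qDip_eq_sum]
    simp only [sub_sub]
  · congr 2
    ext k
    have e : ∀ i : ℕ × ℕ, mono ((i.1 * m) • (b 1 - b 2) + i.2 • b 0) (torusPt k) =
        Complex.exp ((2 * m * k.2 : ℝ) * Complex.I) ^ i.1 *
          Complex.exp ((2 * k.1 : ℝ) * Complex.I) ^ i.2 := by
      intro i
      rw [mono_add, ContinuousMap.mul_apply, mono_nsmul, mono_nsmul, mono_b0, mul_comm i.1, pow_mul]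
      congr 2
      rw [mono_torusPt, ← Complex.exp_nat_mul]
      congr 1
      simp [b]; ring
    simp_rw [e]
    rw [Finset.sum_product]
    simp_rw [← Finset.mul_sum]
    rw [← Finset.sum_mul, norm_mul, mul_pow, ← norm_sum_exp_sq_mul_sin_sq n k.1]
    ring

/-! ### Singularities of the profile -/

/-- The continuum approximation of the profile near the origin. -/
noncomputable def kernel₀ (p d : ℝ) : ℝ := 4 * d ^ 2 / (3 * p ^ 2 + d ^ 2) ^ 2

theorem kernel₀_nonneg (p d : ℝ) : 0 ≤ kernel₀ p d := by unfold kernel₀; positivity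

/-- Here X = 1 - cos p and Y = 1 - cos d, and X + Y ≤ 2 is the half of the cell where p + d ≤ π,
whose only singularity is the origin. -/
theorem profile_den_ge {X Y : ℝ} (hX : 0 ≤ X) (hY : 0 ≤ Y) (h : X + Y ≤ 2) :
    (X + Y) ^ 2 / 2 ≤ (X - Y) ^ 2 + 4 * X * (2 - X) * (X + Y - X * Y) := by
  have h1 : (X + Y) / 2 ≤ X + Y - X * Y := by nlinarith [sq_nonneg (X - Y)]
  have h1' : 0 ≤ X + Y - X * Y := by linarith
  rcases le_total X 1 with hX1 | hX1
  · have : 4 * X * 1 * ((X + Y) / 2) ≤ 4 * X * (2 - X) * (X + Y - X * Y) := by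
      gcongr
      · nlinarith
      · linarith
    nlinarith [sq_nonneg (X - Y)]
  · have : 4 * X * Y * ((X + Y) / 2) ≤ 4 * X * (2 - X) * (X + Y - X * Y) := by
      gcongr
      · nlinarith
      · linarith
    have : 0 ≤ X * Y * (X + Y - 1) := mul_nonneg (mul_nonneg hX hY) (by linarith)
    nlinarith [sq_nonneg (X - Y)]

theorem profile_eq (p d : ℝ) : profile p d =
    (2 * (1 - Real.cos d) + (1 - Real.cos p) ^ 2 - 2 * (1 - Real.cos p) * (1 - Real.cos d)) /
    (((1 - Real.cos p) - (1 - Real.cos d)) ^ 2 + 4 * (1 - Real.cos p) * (2 - (1 - Real.cos p)) *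
      ((1 - Real.cos p) + (1 - Real.cos d) - (1 - Real.cos p) * (1 - Real.cos d))) := by
  unfold profile; congr 1 <;> ring

theorem abs_div_sub_div_le {a b c e K : ℝ} (hb : 0 < b) (he : 0 < e)
    (h : |a * e - c * b| ≤ K * (b * e)) : |a / b - c / e| ≤ K := by
  rw [div_sub_div _ _ hb.ne' he.ne', abs_div, abs_of_pos (mul_pos hb he),
    div_le_iff₀ (mul_pos hb he), mul_comm b c]
  exact h

/-- The quadratic part of the denominator, (X - Y)² + 8X(X + Y), is the perfect square (3X + Y)².
After cross-multiplication only terms of degree at least four remain, against a product of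
denominators of at least (X + Y)⁴/2. -/
theorem abs_profile_sub_le_aux {X Y : ℝ} (hX : 0 ≤ X) (hY : 0 ≤ Y) (h : X + Y ≤ 2)
    (h0 : 0 < X + Y) :
    |(2 * Y + X ^ 2 - 2 * X * Y) / ((X - Y) ^ 2 + 4 * X * (2 - X) * (X + Y - X * Y)) -
      2 * Y / (3 * X + Y) ^ 2| ≤ 114 := by
  have hden := profile_den_ge hX hY h
  have hs : (X + Y) ^ 2 ≤ (3 * X + Y) ^ 2 := by gcongr; linarith
  have hd0 : 0 < (X - Y) ^ 2 + 4 * X * (2 - X) * (X + Y - X * Y) :=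
    lt_of_lt_of_le (by positivity) hden
  have hpos : 0 < 3 * X + Y := by linarith
  refine abs_div_sub_div_le hd0 (by positivity) ?_
  have hprod : (X + Y) ^ 4 / 2 ≤
      ((X - Y) ^ 2 + 4 * X * (2 - X) * (X + Y - X * Y)) * (3 * X + Y) ^ 2 := by
    calc (X + Y) ^ 4 / 2 = (X + Y) ^ 2 / 2 * (X + Y) ^ 2 := by ring
      _ ≤ _ := mul_le_mul hden hs (by positivity) hd0.le
  refine le_trans ?_ (mul_le_mul_of_nonneg_left hprod (by norm_num))
  have e : (2 * Y + X ^ 2 - 2 * X * Y) * (3 * X + Y) ^ 2 -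
      2 * Y * ((X - Y) ^ 2 + 4 * X * (2 - X) * (X + Y - X * Y)) =
      (X ^ 2 - 2 * X * Y) * (3 * X + Y) ^ 2 + 2 * Y * (4 * X ^ 3 + 12 * X ^ 2 * Y - 4 * X ^ 3 * Y) := by
    ring
  rw [e]
  have hY2 : Y ≤ 2 := by linarith
  have h1 : X ^ 3 * Y ≤ X ^ 3 * 2 := by gcongr
  have h2 : X ^ 3 * Y * Y ≤ X ^ 3 * 2 * Y := by gcongr
  have p1 : 0 ≤ X ^ 3 * Y := by positivity
  have p2 : 0 ≤ X ^ 2 * Y ^ 2 := by positivity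
  have p3 : 0 ≤ X * Y ^ 3 := by positivity
  have p4 : 0 ≤ X ^ 4 := by positivity
  have p5 : 0 ≤ Y ^ 4 := by positivity
  have p6 : 0 ≤ X ^ 3 * Y ^ 2 := by positivity
  rw [abs_le]
  constructor <;> nlinarith

theorem one_sub_cos_bounds {p : ℝ} (h0 : 0 ≤ p) (h1 : p ≤ Real.pi) :
    1 - Real.cos p ≤ p ^ 2 / 2 ∧ 2 / 5 * (p ^ 2 / 2) ≤ 1 - Real.cos p ∧
      p ^ 2 / 2 - (1 - Real.cos p) ≤ 2 * (p ^ 2 / 2) ^ 2 := by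
  have a1 : 1 - Real.cos p ≤ p ^ 2 / 2 := by linarith [Real.one_sub_sq_div_two_le_cos (x := p)]
  refine ⟨a1, ?_, ?_⟩
  · have := Real.cos_le_one_sub_mul_cos_sq (x := p) (by rw [abs_of_nonneg h0]; exact h1)
    have h2 : Real.pi ^ 2 ≤ 10 := by nlinarith [Real.pi_lt_d2, Real.pi_pos]
    have h3 : 1 / 5 ≤ 2 / Real.pi ^ 2 := by
      rw [div_le_div_iff₀ (by norm_num) (by positivity)]; linarith
    nlinarith [sq_nonneg p]
  · rcases le_total p 1 with hp | hp
    · have := Real.cos_bound (x := p) (by rw [abs_of_nonneg h0]; exact hp)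
      rw [abs_le, abs_of_nonneg h0] at this
      nlinarith [pow_nonneg h0 4]
    · have := Real.cos_le_one p
      nlinarith [mul_self_nonneg (p - 1)]

/-- Replaces 1 - cos by half the square of the angle: a quadratically small change in the variables
of a function homogeneous of degree -1 costs only a bounded error. -/
theorem abs_kernel₀_sub_le_aux {X Y x y : ℝ} (hx : 0 ≤ x) (hy : 0 ≤ y) (h0 : 0 < x + y)
    (hX1 : X ≤ x) (hX2 : 2 / 5 * x ≤ X) (hX3 : x - X ≤ 2 * x ^ 2)
    (hY1 : Y ≤ y) (hY2 : 2 / 5 * y ≤ Y) (hY3 : y - Y ≤ 2 * y ^ 2) :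
    |2 * Y / (3 * X + Y) ^ 2 - 2 * y / (3 * x + y) ^ 2| ≤ 75 := by
  have hr : 0 < 3 * x + y := by linarith
  have hR : 2 / 5 * (3 * x + y) ≤ 3 * X + Y := by linarith
  have hR0 : 0 < 3 * X + Y := by linarith
  refine abs_div_sub_div_le (by positivity) (by positivity) ?_
  have hprod : 4 / 25 * (3 * x + y) ^ 4 ≤ (3 * X + Y) ^ 2 * (3 * x + y) ^ 2 := by
    have : (2 / 5 * (3 * x + y)) ^ 2 ≤ (3 * X + Y) ^ 2 := by gcongr
    nlinarith [sq_nonneg (3 * x + y)]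
  refine le_trans ?_ (mul_le_mul_of_nonneg_left hprod (by norm_num))
  set r := 3 * x + y with hrdef
  set R := 3 * X + Y with hRdef
  have hRr : R ≤ r := by linarith
  have hyr : y ≤ r := by linarith
  have b1 : y - Y ≤ 2 * r ^ 2 := by
    refine hY3.trans ?_
    gcongr
  have b2 : r - R ≤ 2 * r ^ 2 := by
    have : r - R ≤ 6 * x ^ 2 + 2 * y ^ 2 := by linarith
    rw [hrdef] at *
    nlinarith [mul_nonneg hx hy, sq_nonneg x]
  have e : 2 * Y * r ^ 2 - 2 * y * R ^ 2 = 2 * (y * ((r - R) * (r + R)) - (y - Y) * r ^ 2) := by ring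
  rw [e]
  have c1 : 0 ≤ y * ((r - R) * (r + R)) :=
    mul_nonneg hy (mul_nonneg (by linarith) (by linarith))
  have c2 : y * ((r - R) * (r + R)) ≤ r * ((2 * r ^ 2) * (r + r)) := by
    gcongr
  have c3 : 0 ≤ (y - Y) * r ^ 2 := mul_nonneg (by linarith) (by positivity)
  have c4 : (y - Y) * r ^ 2 ≤ 2 * r ^ 2 * r ^ 2 := by gcongr
  rw [abs_le]
  constructor <;> nlinarith [pow_pos hr 4]

theorem abs_profile_sub_kernel₀_le {p d : ℝ} (hp0 : 0 ≤ p) (hp1 : p ≤ Real.pi) (hd0 : 0 ≤ d)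
    (hd1 : d ≤ Real.pi) (h : p + d ≤ Real.pi) : |profile p d - kernel₀ p d| ≤ 189 := by
  -- At the origin both quotients are 0/0, that is 0.
  by_cases hz : p = 0 ∧ d = 0
  · rw [hz.1, hz.2]; norm_num [profile, kernel₀]
  have hpos : 0 < p ^ 2 / 2 + d ^ 2 / 2 := by
    by_contra hn
    apply hz
    constructor <;> nlinarith [sq_nonneg p, sq_nonneg d]
  obtain ⟨a1, a2, a3⟩ := one_sub_cos_bounds hp0 hp1
  obtain ⟨b1, b2, b3⟩ := one_sub_cos_bounds hd0 hd1
  have hsum : (1 - Real.cos p) + (1 - Real.cos d) ≤ 2 := by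
    have := Real.cos_le_cos_of_nonneg_of_le_pi hd0 (by linarith) (show d ≤ Real.pi - p by linarith)
    rw [Real.cos_pi_sub] at this
    linarith
  have e1 := abs_profile_sub_le_aux (sub_nonneg.2 (Real.cos_le_one p))
    (sub_nonneg.2 (Real.cos_le_one d)) hsum (by linarith)
  rw [← profile_eq] at e1
  have e2 := abs_kernel₀_sub_le_aux (by positivity) (by positivity) hpos a1 a2 a3 b1 b2 b3
  have e3 : kernel₀ p d = 2 * (d ^ 2 / 2) / (3 * (p ^ 2 / 2) + d ^ 2 / 2) ^ 2 := by
    rw [kernel₀, show 3 * (p ^ 2 / 2) + d ^ 2 / 2 = (3 * p ^ 2 + d ^ 2) / 2 by ring, div_pow,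
      div_div_eq_mul_div]
    ring
  rw [← e3] at e2
  have := abs_sub_le (profile p d) (2 * (1 - Real.cos d) / (3 * (1 - Real.cos p) + (1 - Real.cos d)) ^ 2)
    (kernel₀ p d)
  linarith

theorem kernel₀_le_one {p d : ℝ} (hp : 0 ≤ p) (hd : 0 ≤ d) (h : Real.pi ≤ p + d) :
    kernel₀ p d ≤ 1 := by
  have h3 := Real.pi_gt_three
  have h4 : 4 ≤ 3 * p ^ 2 + d ^ 2 := by nlinarith [sq_nonneg (p - d)]
  rw [kernel₀, div_le_one (by positivity)]
  nlinarith [sq_nonneg p]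

theorem profile_pi_sub (p d : ℝ) : profile (Real.pi - p) (Real.pi - d) = profile p d := by
  unfold profile
  rw [Real.cos_pi_sub, Real.cos_pi_sub]
  congr 1 <;> ring

/-- The profile is a bounded perturbation of its continuum approximations near its two
singularities. -/
theorem abs_profile_sub_le {p d : ℝ} (hp : p ∈ Set.Icc 0 Real.pi) (hd : d ∈ Set.Icc 0 Real.pi) :
    |profile p d - (kernel₀ p d + kernel₀ (Real.pi - p) (Real.pi - d))| ≤ 190 := by
  have key : ∀ {p d : ℝ}, p ∈ Set.Icc 0 Real.pi → d ∈ Set.Icc 0 Real.pi → p + d ≤ Real.pi →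
      |profile p d - (kernel₀ p d + kernel₀ (Real.pi - p) (Real.pi - d))| ≤ 190 := by
    intro p d hp hd h
    have h1 := abs_profile_sub_kernel₀_le hp.1 hp.2 hd.1 hd.2 h
    have h2 := kernel₀_le_one (sub_nonneg.2 hp.2) (sub_nonneg.2 hd.2) (by linarith)
    have h3 := kernel₀_nonneg (Real.pi - p) (Real.pi - d)
    rw [abs_le] at *
    constructor <;> linarith
  rcases le_total (p + d) Real.pi with h | h
  · exact key hp hd h
  · have := key (p := Real.pi - p) (d := Real.pi - d) ⟨by linarith [hp.2], by linarith [hp.1]⟩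
      ⟨by linarith [hd.2], by linarith [hd.1]⟩ (by linarith)
    rwa [profile_pi_sub, sub_sub_cancel, sub_sub_cancel, add_comm (kernel₀ _ _)] at this

/-! ### Integrals of the profile in one variable -/

theorem arctan_bounds {t : ℝ} (ht : 0 < t) :
    Real.pi / 2 - t⁻¹ ≤ Real.arctan t ∧ Real.arctan t ≤ Real.pi / 2 := by
  have h := Real.arctan_inv_of_pos ht
  have h2 := Real.lt_tan (Real.arctan_pos.2 (inv_pos.2 ht)) (Real.arctan_lt_pi_div_two _)
  rw [Real.tan_arctan] at h2
  exact ⟨by linarith, (Real.arctan_lt_pi_div_two t).le⟩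

theorem integral_kernel₀_snd {p : ℝ} (hp : 0 < p) :
    |(∫ d in 0..Real.pi, kernel₀ p d) - Real.pi / √3 * (1 / p)| ≤ 2 := by
  have hπ := Real.pi_pos
  have hA : 0 < √3 * p := by positivity
  have hA2 : (√3 * p) ^ 2 = 3 * p ^ 2 := by rw [mul_pow, Real.sq_sqrt (by norm_num)]
  set A := √3 * p with hAdef
  -- With A = √3 p the kernel is 4d²/(A² + d²)². The arctangent at d = π is π/2 up to A/π, so the
  -- main term is π/A; the remaining errors are at most 1 each.
  have hder : ∀ d : ℝ, HasDerivAt (fun d => -(2 * d) / (A ^ 2 + d ^ 2) + 2 / A * Real.arctan (d / A))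
      (kernel₀ p d) d := by
    intro d
    have hne : A ^ 2 + d ^ 2 ≠ 0 := by positivity
    have h1 := ((hasDerivAt_id d).const_mul 2).neg.div
      (((hasDerivAt_id d).pow 2).const_add (A ^ 2)) hne
    have h2 := (((hasDerivAt_id d).div_const A).arctan).const_mul (2 / A)
    convert! h1.add h2 using 1
    have hne2 : 1 + (d / A) ^ 2 ≠ 0 := by positivity
    rw [kernel₀, ← hA2]
    simp only [id, Pi.pow_apply, Pi.neg_apply]
    field_simp
    ring
  have hcont : Continuous fun d => kernel₀ p d := by
    unfold kernel₀
    refine Continuous.div (by fun_prop) (by fun_prop) fun d => ?_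
    positivity
  rw [intervalIntegral.integral_eq_sub_of_hasDerivAt (fun d _ => hder d)
    (hcont.intervalIntegrable _ _)]
  obtain ⟨a1, a2⟩ := arctan_bounds (div_pos hπ hA)
  have e1 : Real.pi / √3 * (1 / p) = 2 / A * (Real.pi / 2) := by rw [hAdef]; field_simp
  have e2 : 2 / A * (Real.pi / A)⁻¹ = 2 / Real.pi := by field_simp
  have e3 : 2 * Real.pi / (A ^ 2 + Real.pi ^ 2) ≤ 1 := by
    rw [div_le_one (by positivity)]; nlinarith [Real.pi_gt_three]
  have e4 : 0 ≤ 2 * Real.pi / (A ^ 2 + Real.pi ^ 2) := by positivity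
  have e5 : 2 / Real.pi ≤ 1 := by rw [div_le_one hπ]; linarith [Real.pi_gt_three]
  have f1 := mul_le_mul_of_nonneg_left a1 (show 0 ≤ 2 / A by positivity)
  have f2 := mul_le_mul_of_nonneg_left a2 (show 0 ≤ 2 / A by positivity)
  rw [mul_sub, e2] at f1
  rw [e1, zero_div, Real.arctan_zero, neg_div]
  simp only [mul_zero, neg_zero, zero_div]
  rw [abs_le]
  constructor <;> linarith

theorem integral_kernel₀_fst {d : ℝ} (hd : 0 < d) :
    |(∫ p in 0..Real.pi, kernel₀ p d) - Real.pi / √3 * (1 / d)| ≤ 2 := by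
  have hπ := Real.pi_pos
  have hs : √3 ^ 2 = 3 := Real.sq_sqrt (by norm_num)
  have hs0 : 0 < √3 := by positivity
  have hder : ∀ p : ℝ, HasDerivAt
      (fun p => 2 * p / (d ^ 2 + 3 * p ^ 2) + 2 / (√3 * d) * Real.arctan (√3 * p / d))
      (kernel₀ p d) p := by
    intro p
    have hne : d ^ 2 + 3 * p ^ 2 ≠ 0 := by positivity
    have h1 := ((hasDerivAt_id p).const_mul 2).div
      ((((hasDerivAt_id p).pow 2).const_mul 3).const_add (d ^ 2)) hne
    have h2 := (((hasDerivAt_id p).const_mul √3).div_const d).arctan.const_mul (2 / (√3 * d))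
    convert! h1.add h2 using 1
    have hne2 : 1 + (√3 * p / d) ^ 2 ≠ 0 := by positivity
    have e : 1 + (√3 * p / d) ^ 2 = (d ^ 2 + 3 * p ^ 2) / d ^ 2 := by
      field_simp
      rw [hs]
      ring
    simp only [id, Pi.pow_apply]
    rw [kernel₀, e, add_comm (3 * p ^ 2)]
    field_simp
    ring
  have hcont : Continuous fun p => kernel₀ p d := by
    unfold kernel₀
    refine Continuous.div (by fun_prop) (by fun_prop) fun d => ?_
    positivity
  rw [intervalIntegral.integral_eq_sub_of_hasDerivAt (fun d _ => hder d)
    (hcont.intervalIntegrable _ _)]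
  obtain ⟨a1, a2⟩ := arctan_bounds (t := √3 * Real.pi / d) (by positivity)
  have e1 : Real.pi / √3 * (1 / d) = 2 / (√3 * d) * (Real.pi / 2) := by field_simp
  have e2 : 2 / (√3 * d) * (√3 * Real.pi / d)⁻¹ = 2 / (3 * Real.pi) := by
    field_simp; rw [hs]
  have e3 : 2 * Real.pi / (d ^ 2 + 3 * Real.pi ^ 2) ≤ 1 := by
    rw [div_le_one (by positivity)]; nlinarith [Real.pi_gt_three]
  have e4 : 0 ≤ 2 * Real.pi / (d ^ 2 + 3 * Real.pi ^ 2) := by positivity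
  have e5 : 2 / (3 * Real.pi) ≤ 1 := by
    rw [div_le_one (by positivity)]; linarith [Real.pi_gt_three]
  have f1 := mul_le_mul_of_nonneg_left a1 (show 0 ≤ 2 / (√3 * d) by positivity)
  have f2 := mul_le_mul_of_nonneg_left a2 (show 0 ≤ 2 / (√3 * d) by positivity)
  rw [mul_sub, e2] at f1
  rw [e1]
  simp only [mul_zero, zero_div, Real.arctan_zero]
  rw [abs_le]
  constructor <;> linarith

theorem profile_den_pos {p d : ℝ} (h : Real.sin p ≠ 0 ∨ Real.sin d ≠ 0) :
    0 < (Real.cos d - Real.cos p) ^ 2 + 4 * (1 - Real.cos p ^ 2) * (1 - Real.cos p * Real.cos d) := by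
  have hp := Real.sin_sq_add_cos_sq p
  have hd := Real.sin_sq_add_cos_sq d
  have a1 := Real.cos_le_one p
  have a2 := Real.neg_one_le_cos p
  have b1 := Real.cos_le_one d
  have b2 := Real.neg_one_le_cos d
  by_cases hs : Real.sin p = 0
  · have hd' : 0 < Real.sin d ^ 2 := by
      have := h.resolve_left (not_not.2 hs)
      positivity
    rw [hs] at hp
    have h1 : 1 - Real.cos p ^ 2 = 0 := by linarith
    rw [h1]
    have : Real.cos d - Real.cos p ≠ 0 := by
      intro h0
      have : Real.cos d = Real.cos p := by linarith
      rw [this] at hd; linarith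
    have := sq_pos_of_ne_zero this
    linarith
  · have h1 : 0 < Real.sin p ^ 2 := by positivity
    have h2 : 0 < 1 - Real.cos p * Real.cos d := by
      nlinarith [sq_nonneg (Real.cos p - Real.cos d)]
    have h3 : 0 < 4 * (1 - Real.cos p ^ 2) * (1 - Real.cos p * Real.cos d) :=
      mul_pos (by linarith) h2
    positivity

theorem continuous_profile_snd {p : ℝ} (h : Real.sin p ≠ 0) : Continuous fun d => profile p d := by
  unfold profile
  exact Continuous.div (by fun_prop) (by fun_prop) fun d => (profile_den_pos (Or.inl h)).ne'

theorem continuous_profile_fst {d : ℝ} (h : Real.sin d ≠ 0) : Continuous fun p => profile p d := by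
  unfold profile
  exact Continuous.div (by fun_prop) (by fun_prop) fun p => (profile_den_pos (Or.inr h)).ne'

/-- The constant is 190 · 4 + 2 + 2, with π ≤ 4. -/
theorem abs_integral_sub_le {f g h : ℝ → ℝ} {a c : ℝ} (hf : Continuous f) (hg : Continuous g)
    (hh : Continuous h) (hfg : ∀ x ∈ Set.Icc 0 Real.pi, |f x - (g x + h x)| ≤ 190)
    (hga : |(∫ x in 0..Real.pi, g x) - a| ≤ 2) (hhc : |(∫ x in 0..Real.pi, h x) - c| ≤ 2) :
    |(∫ x in 0..Real.pi, f x) - (a + c)| ≤ 764 := by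
  have hi := fun {u : ℝ → ℝ} (hu : Continuous u) => hu.intervalIntegrable (μ := volume) 0 Real.pi
  have h1 : ‖∫ x in 0..Real.pi, (f x - (g x + h x))‖ ≤ 190 * |Real.pi - 0| :=
    intervalIntegral.norm_integral_le_of_norm_le_const fun x hx => by
      rw [Set.uIoc_of_le Real.pi_pos.le] at hx
      exact hfg x ⟨hx.1.le, hx.2⟩
  have hgh : Continuous fun x => g x + h x := hg.add hh
  rw [intervalIntegral.integral_sub (hi hf) (hi hgh),
    intervalIntegral.integral_add (hi hg) (hi hh), sub_zero, abs_of_pos Real.pi_pos,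
    Real.norm_eq_abs] at h1
  have h4 := Real.pi_le_four
  rw [abs_le] at *
  constructor <;> linarith

theorem continuous_kernel₀_snd {p : ℝ} (hp : 0 < p) : Continuous fun d => kernel₀ p d := by
  unfold kernel₀
  exact Continuous.div (by fun_prop) (by fun_prop) fun d => by positivity

theorem continuous_kernel₀_fst {d : ℝ} (hd : 0 < d) : Continuous fun p => kernel₀ p d := by
  unfold kernel₀
  exact Continuous.div (by fun_prop) (by fun_prop) fun p => by positivity

theorem abs_integral_profile_snd_sub_le {p : ℝ} (hp : p ∈ Set.Ioo 0 Real.pi) :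
    |(∫ d in 0..Real.pi, profile p d) - Real.pi / √3 * (1 / p + 1 / (Real.pi - p))| ≤ 764 := by
  rw [mul_add]
  have hp' : 0 < Real.pi - p := sub_pos.2 hp.2
  refine abs_integral_sub_le (continuous_profile_snd (Real.sin_pos_of_mem_Ioo hp).ne')
    (continuous_kernel₀_snd hp.1)
    ((continuous_kernel₀_snd hp').comp (continuous_const.sub continuous_id))
    (fun d hd => abs_profile_sub_le ⟨hp.1.le, hp.2.le⟩ hd) (integral_kernel₀_snd hp.1) ?_
  have := integral_kernel₀_snd hp'
  change |(∫ d in 0..Real.pi, kernel₀ (Real.pi - p) (Real.pi - d)) - _| ≤ 2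
  rwa [intervalIntegral.integral_comp_sub_left (fun d => kernel₀ (Real.pi - p) d) Real.pi, sub_self,
    sub_zero]

theorem abs_integral_profile_fst_sub_le {d : ℝ} (hd : d ∈ Set.Ioo 0 Real.pi) :
    |(∫ p in 0..Real.pi, profile p d) - Real.pi / √3 * (1 / d + 1 / (Real.pi - d))| ≤ 764 := by
  rw [mul_add]
  have hd' : 0 < Real.pi - d := sub_pos.2 hd.2
  refine abs_integral_sub_le (continuous_profile_fst (Real.sin_pos_of_mem_Ioo hd).ne')
    (continuous_kernel₀_fst hd.1)
    ((continuous_kernel₀_fst hd').comp (continuous_const.sub continuous_id))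
    (fun p hp => abs_profile_sub_le hp ⟨hd.1.le, hd.2.le⟩) (integral_kernel₀_fst hd.1) ?_
  have := integral_kernel₀_fst hd'
  change |(∫ p in 0..Real.pi, kernel₀ (Real.pi - p) (Real.pi - d)) - _| ≤ 2
  rwa [intervalIntegral.integral_comp_sub_left (fun p => kernel₀ p (Real.pi - d)) Real.pi, sub_self,
    sub_zero]

/-! ### Bounds for the profile and the wall symbol -/

theorem profile_num_nonneg (p d : ℝ) :
    0 ≤ 1 - 2 * Real.cos p * Real.cos d + Real.cos p ^ 2 := by
  nlinarith [sq_nonneg (Real.cos p - Real.cos d), Real.sin_sq_add_cos_sq d, sq_nonneg (Real.sin d)]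

theorem profile_den_nonneg (p d : ℝ) :
    0 ≤ (Real.cos d - Real.cos p) ^ 2 + 4 * (1 - Real.cos p ^ 2) * (1 - Real.cos p * Real.cos d) := by
  have h1 : 0 ≤ 1 - Real.cos p ^ 2 := by rw [← Real.sin_sq]; positivity
  have h2 : 0 ≤ 1 - Real.cos d ^ 2 := by rw [← Real.sin_sq]; positivity
  have h3 : 0 ≤ 1 - Real.cos p * Real.cos d := by nlinarith [sq_nonneg (Real.cos p - Real.cos d)]
  positivity

theorem profile_nonneg (p d : ℝ) : 0 ≤ profile p d :=
  div_nonneg (profile_num_nonneg p d) (profile_den_nonneg p d)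

/-- The denominator minus 2 sin²p times the numerator is the sum of squares (cos d - cos p)² + 2
sin⁴p. -/
theorem sin_sq_mul_profile_le (p d : ℝ) : Real.sin p ^ 2 * profile p d ≤ 1 / 2 := by
  rw [profile, mul_div_assoc']
  refine div_le_of_le_mul₀ (profile_den_nonneg p d) (by norm_num) ?_
  rw [Real.sin_sq]
  nlinarith [sq_nonneg (Real.cos d - Real.cos p), sq_nonneg (1 - Real.cos p ^ 2)]

theorem sin_nat_mul_sq_le (n : ℕ) (p : ℝ) : Real.sin (n * p) ^ 2 ≤ n ^ 2 * Real.sin p ^ 2 := by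
  rw [← norm_sum_exp_sq_mul_sin_sq]
  gcongr
  refine (norm_sum_le _ _).trans (le_of_eq ?_)
  simp only [norm_pow, Complex.norm_exp_ofReal_mul_I, one_pow, Finset.sum_const, Finset.card_range,
    nsmul_eq_mul, mul_one]

theorem sin_nat_mul_sq_mul_profile_le (n : ℕ) (p d : ℝ) :
    |Real.sin (n * p) ^ 2 * profile p d| ≤ n ^ 2 / 2 := by
  rw [abs_of_nonneg (mul_nonneg (sq_nonneg _) (profile_nonneg p d))]
  calc Real.sin (n * p) ^ 2 * profile p d ≤ n ^ 2 * Real.sin p ^ 2 * profile p d :=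
        mul_le_mul_of_nonneg_right (sin_nat_mul_sq_le n p) (profile_nonneg p d)
    _ = n ^ 2 * (Real.sin p ^ 2 * profile p d) := by ring
    _ ≤ n ^ 2 * (1 / 2) := by gcongr; exact sin_sq_mul_profile_le p d
    _ = n ^ 2 / 2 := by ring

theorem measurable_profile : Measurable fun k : ℝ × ℝ => profile k.1 k.2 := by
  have h1 : Measurable fun k : ℝ × ℝ => 1 - 2 * Real.cos k.1 * Real.cos k.2 + Real.cos k.1 ^ 2 :=
    Continuous.measurable (by fun_prop)
  have h2 : Measurable fun k : ℝ × ℝ => (Real.cos k.2 - Real.cos k.1) ^ 2 +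
      4 * (1 - Real.cos k.1 ^ 2) * (1 - Real.cos k.1 * Real.cos k.2) :=
    Continuous.measurable (by fun_prop)
  exact h1.div h2

theorem measurable_profile_fst (d : ℝ) : Measurable fun p : ℝ => profile p d := by
  have h : Measurable fun p : ℝ => (p, d) := measurable_id.prodMk measurable_const
  have h' := measurable_profile.comp h
  simpa only [Function.comp_def] using h'

theorem measurable_sin_mul_profile (n : ℕ) :
    Measurable fun k : ℝ × ℝ => Real.sin (n * k.1) ^ 2 * profile k.1 k.2 :=
  (show Continuous fun k : ℝ × ℝ => Real.sin (n * k.1) ^ 2 by fun_prop).measurable.mul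
    measurable_profile

theorem integrable_mul_profile (n : ℕ) {w : ℝ × ℝ → ℝ} (hw : Continuous w) {C : ℝ}
    (hC : ∀ k, |w k| ≤ C) :
    Integrable (fun k : ℝ × ℝ => w k * (Real.sin (n * k.1) ^ 2 * profile k.1 k.2)) cell := by
  refine Integrable.of_bound (C := C * (n ^ 2 / 2))
    (hw.measurable.mul (measurable_sin_mul_profile n)).aestronglyMeasurable ?_
  refine Eventually.of_forall fun k => ?_
  rw [Real.norm_eq_abs, abs_mul]
  exact mul_le_mul (hC k) (sin_nat_mul_sq_mul_profile_le n _ _) (abs_nonneg _)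
    ((abs_nonneg _).trans (hC k))

/-- The interaction of a wall at frequency `d`, for the distance `n`. -/
noncomputable def wallSymbol (n : ℕ) (d : ℝ) : ℝ :=
  ∫ p in 0..2 * Real.pi, Real.sin (n * p) ^ 2 * profile p d

/-- Although `profile` is unbounded, sin²(np) tames it: the integrand is at most n²/2, so dominated
convergence applies. Fejér summation needs this continuity. -/
theorem continuous_wallSymbol (n : ℕ) : Continuous (wallSymbol n) := by
  unfold wallSymbol
  refine intervalIntegral.continuous_of_dominated_interval (bound := fun _ => (n : ℝ) ^ 2 / 2)
    (fun d => ?_) (fun d => ?_) intervalIntegrable_const ?_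
  · exact ((measurable_sin_mul_profile n).comp
      (measurable_id.prodMk measurable_const)).aestronglyMeasurable
  · exact Eventually.of_forall fun p _ => sin_nat_mul_sq_mul_profile_le n p d
  · filter_upwards [ae_sin_ne_zero] with p hp _
    exact continuous_const.mul (continuous_profile_snd hp)

theorem profile_add_pi (p d : ℝ) : profile (p + Real.pi) (d + Real.pi) = profile p d := by
  unfold profile
  rw [Real.cos_add_pi, Real.cos_add_pi]
  congr 1 <;> ring

theorem profile_two_pi_sub (p d : ℝ) : profile (2 * Real.pi - p) d = profile p d := by
  unfold profile
  rw [Real.cos_two_pi_sub]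

theorem sin_nat_mul_add_pi_sq (n : ℕ) (p : ℝ) :
    Real.sin (n * (p + Real.pi)) ^ 2 = Real.sin (n * p) ^ 2 := by
  rw [mul_add, Real.sin_add_nat_mul_pi, mul_pow, ← pow_mul, mul_comm n 2, pow_mul, neg_one_sq,
    one_pow, one_mul]

theorem sin_nat_mul_two_pi_sub_sq (n : ℕ) (p : ℝ) :
    Real.sin (n * (2 * Real.pi - p)) ^ 2 = Real.sin (n * p) ^ 2 := by
  rw [mul_sub, Real.sin_nat_mul_two_pi_sub, neg_sq]

/-- The integrand is invariant when p and d are both shifted by π, and the p integral runs over a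
full period. -/
theorem wallSymbol_periodic (n : ℕ) : Function.Periodic (wallSymbol n) Real.pi := by
  intro d
  have h2 : Function.Periodic (fun p => Real.sin (n * p) ^ 2 * profile p (d + Real.pi))
      (2 * Real.pi) := by
    intro p
    have e : p + 2 * Real.pi = p + Real.pi + Real.pi := by ring
    simp only
    rw [e, sin_nat_mul_add_pi_sq, sin_nat_mul_add_pi_sq]
    unfold profile
    rw [← e, Real.cos_add_two_pi]
  have h3 := h2.intervalIntegral_add_eq Real.pi 0
  rw [zero_add] at h3
  rw [wallSymbol, ← h3, wallSymbol]
  have := intervalIntegral.integral_comp_add_right (a := 0) (b := 2 * Real.pi)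
    (fun p => Real.sin (n * p) ^ 2 * profile p (d + Real.pi)) Real.pi
  rw [zero_add, add_comm (2 * Real.pi)] at this
  rw [← this]
  simp only [sin_nat_mul_add_pi_sq, profile_add_pi]

theorem integral_two_pi_eq {f : ℝ → ℝ} (hf : ∀ a c, IntervalIntegrable f volume a c)
    (h : ∀ p, f (2 * Real.pi - p) = f p) :
    ∫ p in 0..2 * Real.pi, f p = 2 * ∫ p in 0..Real.pi, f p := by
  have h1 := intervalIntegral.integral_add_adjacent_intervals (hf 0 Real.pi)
    (hf Real.pi (2 * Real.pi))
  have h2 := intervalIntegral.integral_comp_sub_left (a := 0) (b := Real.pi) f (2 * Real.pi)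
  simp only [h, sub_zero] at h2
  rw [show 2 * Real.pi - Real.pi = Real.pi by ring] at h2
  rw [← h1, ← h2]; ring

/-! ### The dipole -/

theorem abs_inv_sin_sub_le {p : ℝ} (hp : p ∈ Set.Ioo 0 Real.pi) :
    |1 / p + 1 / (Real.pi - p) - 1 / Real.sin p| ≤ 3 := by
  have h3 := Real.pi_gt_three
  have h4 := Real.pi_le_four
  have key : ∀ {p : ℝ}, 0 < p → p ≤ Real.pi / 2 →
      |1 / p + 1 / (Real.pi - p) - 1 / Real.sin p| ≤ 3 := by
    intro p h0 h1
    have hs : 2 / Real.pi * p ≤ Real.sin p := Real.mul_le_sin h0.le h1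
    have hs' : p / 2 ≤ Real.sin p := by
      refine le_trans ?_ hs
      rw [div_eq_inv_mul]
      gcongr
      rw [inv_eq_one_div, div_le_div_iff₀ (by norm_num) (by linarith)]
      linarith
    have hs0 : 0 < Real.sin p := by linarith
    have hs1 : Real.sin p ≤ p := Real.sin_le h0.le
    have a1 : 0 ≤ 1 / (Real.pi - p) := one_div_nonneg.2 (by linarith)
    have a2 : 1 / (Real.pi - p) ≤ 1 := by rw [div_le_one] <;> linarith
    have a3 : 1 / p ≤ 1 / Real.sin p := one_div_le_one_div_of_le hs0 hs1
    have a4 : 1 / Real.sin p - 1 / p ≤ 2 := by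
      rw [div_sub_div _ _ hs0.ne' h0.ne', div_le_iff₀ (mul_pos hs0 h0)]
      rcases le_total p 1 with hp1 | hp1
      · have := Real.sin_gt_sub_cube h0
        nlinarith [mul_pos h0 h0, mul_le_mul_of_nonneg_right hs' h0.le,
          mul_nonneg (mul_nonneg h0.le h0.le) (sub_nonneg.2 hp1)]
      · nlinarith
    rw [abs_le]
    constructor <;> linarith
  rcases le_total p (Real.pi / 2) with h | h
  · exact key hp.1 h
  · have := key (p := Real.pi - p) (by linarith [hp.2]) (by linarith)
    rwa [Real.sin_pi_sub, sub_sub_cancel, add_comm (1 / (Real.pi - p))] at this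

theorem pi_div_sqrt_three_le : Real.pi / √3 ≤ 4 := by
  have h3 : 1 ≤ √3 := Real.one_le_sqrt.2 (by norm_num)
  rw [div_le_iff₀ (by linarith)]
  linarith [Real.pi_le_four]

theorem abs_integral_profile_sub_inv_sin_le {p : ℝ} (hp : p ∈ Set.Ioo 0 Real.pi) :
    |(∫ d in 0..Real.pi, profile p d) - Real.pi / √3 * (1 / Real.sin p)| ≤ 776 := by
  have h1 := abs_integral_profile_snd_sub_le hp
  have h2 := abs_inv_sin_sub_le hp
  have h3 : |Real.pi / √3 * (1 / p + 1 / (Real.pi - p) - 1 / Real.sin p)| ≤ 4 * 3 := by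
    rw [abs_mul, abs_of_nonneg (by positivity : 0 ≤ Real.pi / √3)]
    exact mul_le_mul pi_div_sqrt_three_le h2 (abs_nonneg _) (by norm_num)
  rw [mul_sub] at h3
  rw [abs_le] at *
  constructor <;> linarith

/-- Makes sin²(np)/sin p a trigonometric polynomial, so the logarithm of the dipole can be
integrated exactly. -/
theorem sin_nat_mul_sq_eq (n : ℕ) (p : ℝ) : Real.sin (n * p) ^ 2 =
    Real.sin p * ∑ k ∈ Finset.range n, Real.sin ((2 * k + 1) * p) := by
  induction n with
  | zero => simp
  | succ n ih =>
    rw [Finset.sum_range_succ, mul_add, ← ih]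
    have e1 : ((n + 1 : ℕ) : ℝ) * p = n * p + p := by push_cast; ring
    have e2 : (2 * (n : ℝ) + 1) * p = n * p + (n * p + p) := by ring
    rw [e1, e2, Real.sin_add (n * p) (n * p + p), Real.sin_add, Real.cos_add]
    have h1 := Real.sin_sq_add_cos_sq p
    generalize Real.sin (n * p) = s at *
    generalize Real.cos (n * p) = c at *
    linear_combination s ^ 2 * h1

theorem integral_sin_odd_mul (k : ℕ) :
    ∫ p in 0..Real.pi, Real.sin ((2 * k + 1) * p) = 2 / (2 * k + 1) := by
  have hk : (2 * (k : ℝ) + 1) ≠ 0 := by positivity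
  rw [intervalIntegral.integral_comp_mul_left (fun x => Real.sin x) hk, integral_sin]
  have : Real.cos ((2 * k + 1) * Real.pi) = -1 := by
    have := Real.cos_nat_mul_two_pi_add_pi k
    rwa [show (k : ℝ) * (2 * Real.pi) + Real.pi = (2 * k + 1) * Real.pi by ring] at this
  rw [this, mul_zero, Real.cos_zero, smul_eq_mul]
  field_simp
  norm_num

/-- Above, log(1 + 1/n) ≥ 2/(2n + 1) gives an induction; below, compare with the harmonic sum. -/
theorem abs_sum_odd_sub_log_le {n : ℕ} (hn : 1 ≤ n) :
    |(∑ k ∈ Finset.range n, 2 / (2 * (k : ℝ) + 1)) - Real.log n| ≤ 2 := by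
  have hup : (∑ k ∈ Finset.range n, 2 / (2 * (k : ℝ) + 1)) ≤ Real.log n + 2 := by
    induction n, hn using Nat.le_induction with
    | base => simp
    | succ n hn ih =>
      rw [Finset.sum_range_succ]
      have hn0 : (0 : ℝ) < n := by exact_mod_cast hn
      have h1 := Real.le_log_one_add_of_nonneg (x := 1 / (n : ℝ)) (by positivity)
      have h2 : 2 * (1 / (n : ℝ)) / (1 / (n : ℝ) + 2) = 2 / (2 * n + 1) := by
        field_simp
        ring
      have h3 : Real.log ((n + 1 : ℕ) : ℝ) = Real.log n + Real.log (1 + 1 / (n : ℝ)) := by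
        rw [← Real.log_mul hn0.ne' (by positivity)]
        congr 1
        push_cast
        field_simp
      rw [h3]
      linarith
  have hlow : Real.log n ≤ ∑ k ∈ Finset.range n, 2 / (2 * (k : ℝ) + 1) := by
    have h1 := log_add_one_le_harmonic n
    have h2 : Real.log n ≤ Real.log ((n + 1 : ℕ) : ℝ) :=
      Real.log_le_log (by exact_mod_cast hn) (by push_cast; linarith)
    refine (h2.trans h1).trans ?_
    rw [harmonic]
    push_cast
    refine Finset.sum_le_sum fun k _ => ?_
    rw [inv_eq_one_div, div_le_div_iff₀ (by positivity) (by positivity)]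
    linarith
  rw [abs_le]
  constructor <;> linarith

theorem integral_cell_eq (n : ℕ) : ∫ k, Real.sin (n * k.1) ^ 2 * profile k.1 k.2 ∂cell =
    2 * ∫ p in 0..Real.pi, Real.sin (n * p) ^ 2 * ∫ d in 0..Real.pi, profile p d := by
  have hint : Integrable (fun k : ℝ × ℝ => Real.sin (n * k.1) ^ 2 * profile k.1 k.2) cell := by
    simpa using integrable_mul_profile n (w := fun _ => 1) continuous_const (C := 1) (by simp)
  have hi : ∀ p, ∫ d in Set.Ioc 0 Real.pi, Real.sin (n * p) ^ 2 * profile p d =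
      Real.sin (n * p) ^ 2 * ∫ d in 0..Real.pi, profile p d := by
    intro p
    rw [integral_const_mul, intervalIntegral.integral_of_le Real.pi_pos.le]
  have h1 := integral_prod _ (show Integrable _ (Measure.prod _ _) from hint)
  have h2 := (show Integrable _ (Measure.prod _ _) from hint).integral_prod_left
  simp only [hi] at h1 h2
  rw [cell, h1, ← intervalIntegral.integral_of_le (by positivity)]
  have h3 : IntervalIntegrable (fun p => Real.sin (n * p) ^ 2 * ∫ d in 0..Real.pi, profile p d)
      volume 0 (2 * Real.pi) := by
    rw [intervalIntegrable_iff_integrableOn_Ioc_of_le (by positivity)]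
    exact h2
  have hπ := Real.pi_pos
  have h4 := intervalIntegral.integral_add_adjacent_intervals
    (h3.mono_set (c := 0) (d := Real.pi) (by
      rw [Set.uIcc_of_le hπ.le, Set.uIcc_of_le (by positivity)]
      exact Set.Icc_subset_Icc_right (by linarith)))
    (h3.mono_set (c := Real.pi) (d := 2 * Real.pi) (by
      rw [Set.uIcc_of_le (by linarith), Set.uIcc_of_le (by positivity)]
      exact Set.Icc_subset_Icc_left hπ.le))
  have h5 := intervalIntegral.integral_comp_sub_left (a := 0) (b := Real.pi)
    (fun p => Real.sin (n * p) ^ 2 * ∫ d in 0..Real.pi, profile p d) (2 * Real.pi)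
  simp only [sin_nat_mul_two_pi_sub_sq, profile_two_pi_sub, sub_zero] at h5
  rw [show 2 * Real.pi - Real.pi = Real.pi by ring] at h5
  rw [← h4, ← h5]; ring

theorem abs_dipole_sub_log_le {n : ℕ} (hn : 1 ≤ n) :
    |1 / (4 * Real.pi ^ 2) * (∫ k, Real.sin (n * k.1) ^ 2 * profile k.1 k.2 ∂cell) -
      Real.log n / (2 * Real.pi * √3)| ≤ 3200 := by
  have hπ := Real.pi_pos
  set J : ℝ → ℝ := fun p => ∫ d in 0..Real.pi, profile p d with hJ
  set S : ℝ → ℝ := fun p => ∑ k ∈ Finset.range n, Real.sin ((2 * k + 1) * p) with hS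
  have hSc : Continuous S := by fun_prop
  have hSint : ∫ p in 0..Real.pi, S p = ∑ k ∈ Finset.range n, 2 / (2 * (k : ℝ) + 1) := by
    rw [hS, intervalIntegral.integral_finsetSum fun k _ =>
      Continuous.intervalIntegrable (by fun_prop) _ _]
    exact Finset.sum_congr rfl fun k _ => integral_sin_odd_mul k
  have hint : IntervalIntegrable (fun p => Real.sin (n * p) ^ 2 * J p) volume 0 Real.pi := by
    have hint : Integrable (fun k : ℝ × ℝ => Real.sin (n * k.1) ^ 2 * profile k.1 k.2) cell := by
      simpa using integrable_mul_profile n (w := fun _ => 1) continuous_const (C := 1) (by simp)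
    have hi : ∀ p, ∫ d in Set.Ioc 0 Real.pi, Real.sin (n * p) ^ 2 * profile p d =
        Real.sin (n * p) ^ 2 * J p := by
      intro p
      simp only [hJ]
      rw [integral_const_mul, intervalIntegral.integral_of_le Real.pi_pos.le]
    have h2 := (show Integrable _ (Measure.prod _ _) from hint).integral_prod_left
    simp only [hi] at h2
    rw [intervalIntegrable_iff_integrableOn_Ioc_of_le (by positivity)]
    exact IntegrableOn.mono_set h2 (Set.Ioc_subset_Ioc_right (by linarith))
  have hb : ‖∫ p in 0..Real.pi, (Real.sin (n * p) ^ 2 * J p - Real.pi / √3 * S p)‖ ≤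
      776 * |Real.pi - 0| := by
    refine intervalIntegral.norm_integral_le_of_norm_le_const_ae ?_
    -- The pointwise estimate holds only in the open interval; the endpoint π, where 1/sin p is
    -- singular, is discarded as a null set.
    have hne : ∀ᵐ p : ℝ, p ≠ Real.pi := (Set.countable_singleton Real.pi).ae_notMem volume
    filter_upwards [hne] with p hp hp'
    rw [Set.uIoc_of_le hπ.le] at hp'
    have hpI : p ∈ Set.Ioo 0 Real.pi := ⟨hp'.1, lt_of_le_of_ne hp'.2 hp⟩
    have hs := Real.sin_pos_of_mem_Ioo hpI
    have e : Real.pi / √3 * S p = Real.sin (n * p) ^ 2 * (Real.pi / √3 * (1 / Real.sin p)) := by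
      rw [sin_nat_mul_sq_eq]
      field_simp
      rfl
    rw [e, ← mul_sub, norm_mul, Real.norm_eq_abs, Real.norm_eq_abs, abs_of_nonneg (sq_nonneg _)]
    have h1 := abs_integral_profile_sub_inv_sin_le hpI
    have h2 := Real.sin_sq_le_one (n * p)
    calc _ ≤ 1 * (776 : ℝ) := mul_le_mul h2 h1 (abs_nonneg _) zero_le_one
      _ = 776 := one_mul _
  rw [intervalIntegral.integral_sub hint ((hSc.const_mul _).intervalIntegrable _ _),
    intervalIntegral.integral_const_mul, hSint, Real.norm_eq_abs, sub_zero, abs_of_pos hπ] at hb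
  have ho := abs_sum_odd_sub_log_le hn
  set O := ∑ k ∈ Finset.range n, 2 / (2 * (k : ℝ) + 1) with hO
  have h3 : |Real.pi / √3 * (O - Real.log n)| ≤ 4 * 2 := by
    rw [abs_mul, abs_of_nonneg (by positivity : 0 ≤ Real.pi / √3)]
    exact mul_le_mul pi_div_sqrt_three_le ho (abs_nonneg _) (by norm_num)
  rw [integral_cell_eq]
  set I := ∫ p in 0..Real.pi, Real.sin (n * p) ^ 2 * ∫ d in 0..Real.pi, profile p d with hI
  have e : 1 / (4 * Real.pi ^ 2) * (2 * I) - Real.log n / (2 * Real.pi * √3) =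
      1 / (2 * Real.pi ^ 2) * ((I - Real.pi / √3 * O) + Real.pi / √3 * (O - Real.log n)) := by
    field_simp
    ring
  rw [e, abs_mul, abs_of_pos (by positivity)]
  have h5 : 1 / (2 * Real.pi ^ 2) ≤ 1 := by
    rw [div_le_one (by positivity)]; nlinarith [Real.pi_gt_three]
  have h6 : |(I - Real.pi / √3 * O) + Real.pi / √3 * (O - Real.log n)| ≤ 3200 := by
    refine (abs_add_le _ _).trans ?_
    linarith [Real.pi_le_four]
  calc _ ≤ 1 * (3200 : ℝ) := mul_le_mul h5 h6 (abs_nonneg _) zero_le_one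
    _ = 3200 := one_mul _

/-! ### Fejér summation along the wall -/

/-- The square of the Dirichlet-type sum of a wall of `M` equally spaced sources. -/
noncomputable def wallFactor (M m : ℕ) (d : ℝ) : ℝ :=
  ‖∑ j ∈ Finset.Icc 1 M, Complex.exp ((2 * m * d : ℝ) * Complex.I) ^ j‖ ^ 2

theorem continuous_wallFactor (M m : ℕ) : Continuous (wallFactor M m) := by
  unfold wallFactor; fun_prop

theorem wallFactor_nonneg (M m : ℕ) (d : ℝ) : 0 ≤ wallFactor M m d := by
  unfold wallFactor; positivity

theorem wallFactor_le (M m : ℕ) (d : ℝ) : wallFactor M m d ≤ M ^ 2 := by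
  unfold wallFactor
  gcongr
  refine (norm_sum_le _ _).trans (le_of_eq ?_)
  simp only [norm_pow, Complex.norm_exp_ofReal_mul_I, one_pow, Finset.sum_const, Nat.card_Icc,
    nsmul_eq_mul, mul_one, add_tsub_cancel_right]

theorem wallFactor_mul_exp (M m : ℕ) (d : ℝ) (k : ℤ) :
    (wallFactor M m d : ℂ) * Complex.exp (Complex.I * (d * (2 * k))) =
      ∑ j ∈ Finset.Icc 1 M, ∑ l ∈ Finset.Icc 1 M,
        Complex.exp (Complex.I * (d * (2 * ((m * ((j : ℤ) - l) + k : ℤ) : ℂ)))) := by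
  rw [wallFactor, Complex.ofReal_pow, ← Complex.mul_conj', map_sum, Finset.sum_mul_sum,
    Finset.sum_mul]
  refine Finset.sum_congr rfl fun j _ => ?_
  rw [Finset.sum_mul]
  refine Finset.sum_congr rfl fun l _ => ?_
  rw [map_pow, ← Complex.exp_conj, ← Complex.exp_nat_mul, ← Complex.exp_nat_mul, ← Complex.exp_add,
    ← Complex.exp_add]
  congr 1
  simp only [map_mul, Complex.conj_ofReal, Complex.conj_I]
  push_cast
  ring

theorem integral_wallFactor_mul_exp (M m : ℕ) (k : ℤ) :
    ∫ d in 0..Real.pi, (wallFactor M m d : ℂ) * Complex.exp (Complex.I * (d * (2 * k))) =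
      ∑ j ∈ Finset.Icc 1 M, ∑ l ∈ Finset.Icc 1 M,
        if (m * ((j : ℤ) - l) + k : ℤ) = 0 then (Real.pi : ℂ) else 0 := by
  simp_rw [wallFactor_mul_exp]
  rw [intervalIntegral.integral_finsetSum fun j _ => Continuous.intervalIntegrable (by fun_prop) _ _]
  refine Finset.sum_congr rfl fun j _ => ?_
  rw [intervalIntegral.integral_finsetSum fun j _ => Continuous.intervalIntegrable (by fun_prop) _ _]
  refine Finset.sum_congr rfl fun l _ => ?_
  rw [intervalIntegral.integral_of_le Real.pi_pos.le, integral_exp_two_int_mul]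

instance : Fact (0 < Real.pi) := ⟨Real.pi_pos⟩

/-- The normalized integral against the wall factor. -/
noncomputable def wallMean (M m : ℕ) (g : C(AddCircle Real.pi, ℂ)) : ℂ :=
  1 / M * ∫ d in 0..Real.pi, (wallFactor M m d : ℂ) * g (d : AddCircle Real.pi)

theorem continuous_wallMean_integrand (M m : ℕ) (g : C(AddCircle Real.pi, ℂ)) :
    Continuous fun d : ℝ => (wallFactor M m d : ℂ) * g (d : AddCircle Real.pi) :=
  (Complex.continuous_ofReal.comp (continuous_wallFactor M m)).mul
    (g.continuous.comp (AddCircle.continuous_mk' _))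

theorem wallMean_add (M m : ℕ) (f g : C(AddCircle Real.pi, ℂ)) :
    wallMean M m (f + g) = wallMean M m f + wallMean M m g := by
  simp only [wallMean, ContinuousMap.add_apply, mul_add]
  rw [intervalIntegral.integral_add ((continuous_wallMean_integrand M m f).intervalIntegrable _ _)
    ((continuous_wallMean_integrand M m g).intervalIntegrable _ _), mul_add]

theorem wallMean_smul (M m : ℕ) (c : ℂ) (f : C(AddCircle Real.pi, ℂ)) :
    wallMean M m (c • f) = c * wallMean M m f := by
  simp only [wallMean, ContinuousMap.smul_apply, smul_eq_mul]
  simp_rw [mul_left_comm _ c]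
  rw [intervalIntegral.integral_const_mul, mul_left_comm]

/-- Only the diagonal pairs j = l survive, so the mass of the factor is proportional to M and the
means are uniformly bounded functionals. -/
theorem integral_wallFactor (M : ℕ) {m : ℕ} (hm : 1 ≤ m) :
    ∫ d in 0..Real.pi, wallFactor M m d = M * Real.pi := by
  have h := integral_wallFactor_mul_exp M m 0
  simp only [Int.cast_zero, mul_zero, Complex.exp_zero, mul_one, add_zero] at h
  have e : ∀ j l : ℕ, ((m * ((j : ℤ) - l) : ℤ) = 0) ↔ j = l := by
    intro j l
    rw [mul_eq_zero, sub_eq_zero]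
    omega
  simp only [e, Finset.sum_ite_eq] at h
  rw [Finset.sum_ite_mem, Finset.inter_self, Finset.sum_const, Nat.card_Icc,
    intervalIntegral.integral_ofReal, nsmul_eq_mul] at h
  apply Complex.ofReal_injective
  rw [h]
  push_cast
  simp

theorem norm_wallMean_le (M : ℕ) {m : ℕ} (hm : 1 ≤ m) (g : C(AddCircle Real.pi, ℂ)) :
    ‖wallMean M m g‖ ≤ Real.pi * ‖g‖ := by
  have h : ‖∫ d in 0..Real.pi, (wallFactor M m d : ℂ) * g (d : AddCircle Real.pi)‖ ≤
      ∫ d in 0..Real.pi, wallFactor M m d * ‖g‖ := by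
    refine intervalIntegral.norm_integral_le_of_norm_le Real.pi_pos.le ?_
      (((continuous_wallFactor M m).mul continuous_const).intervalIntegrable _ _)
    refine Eventually.of_forall fun d _ => ?_
    rw [norm_mul, Complex.norm_real, Real.norm_eq_abs, abs_of_nonneg (wallFactor_nonneg _ _ _)]
    exact mul_le_mul_of_nonneg_left (g.norm_coe_le_norm _) (wallFactor_nonneg _ _ _)
  rw [intervalIntegral.integral_mul_const, integral_wallFactor M hm] at h
  rw [wallMean, norm_mul, norm_div, norm_one, Complex.norm_natCast]
  rcases Nat.eq_zero_or_pos M with rfl | hM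
  · simp only [Nat.cast_zero, div_zero, zero_mul]; positivity
  · have hM' : (0 : ℝ) < M := by exact_mod_cast hM
    calc 1 / (M : ℝ) * _ ≤ 1 / (M : ℝ) * (M * Real.pi * ‖g‖) := by gcongr
      _ = Real.pi * ‖g‖ := by field_simp

/-- The limit of the means `wallMean`. -/
noncomputable def wallLimit (m : ℕ) (g : C(AddCircle Real.pi, ℂ)) : ℂ :=
  Real.pi / m * ∑ j ∈ Finset.range m, g ((Real.pi * j / m : ℝ) : AddCircle Real.pi)

theorem wallLimit_add (m : ℕ) (f g : C(AddCircle Real.pi, ℂ)) :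
    wallLimit m (f + g) = wallLimit m f + wallLimit m g := by
  simp only [wallLimit, ContinuousMap.add_apply, Finset.sum_add_distrib, mul_add]

theorem wallLimit_smul (m : ℕ) (c : ℂ) (f : C(AddCircle Real.pi, ℂ)) :
    wallLimit m (c • f) = c * wallLimit m f := by
  simp only [wallLimit, ContinuousMap.smul_apply, smul_eq_mul, ← Finset.mul_sum]
  ring

theorem norm_wallLimit_le {m : ℕ} (hm : 1 ≤ m) (g : C(AddCircle Real.pi, ℂ)) :
    ‖wallLimit m g‖ ≤ Real.pi * ‖g‖ := by
  have hm' : (0 : ℝ) < m := by exact_mod_cast hm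
  have h : ‖∑ j ∈ Finset.range m, g ((Real.pi * j / m : ℝ) : AddCircle Real.pi)‖ ≤ m * ‖g‖ := by
    refine (norm_sum_le_of_le _ fun j _ => g.norm_coe_le_norm _).trans (le_of_eq ?_)
    rw [Finset.sum_const, Finset.card_range, nsmul_eq_mul]
  rw [wallLimit, norm_mul, norm_div, Complex.norm_real, Complex.norm_natCast, Real.norm_eq_abs,
    abs_of_pos Real.pi_pos]
  calc Real.pi / m * _ ≤ Real.pi / m * (m * ‖g‖) := by gcongr
    _ = Real.pi * ‖g‖ := by field_simp

theorem fourier_pi_apply (k : ℤ) (d : ℝ) :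
    fourier k (d : AddCircle Real.pi) = Complex.exp (Complex.I * (d * (2 * k))) := by
  have := Complex.ofReal_ne_zero.2 Real.pi_ne_zero
  rw [fourier_coe_apply]
  congr 1
  field_simp

theorem card_shift_bounds (M : ℕ) (r : ℤ) :
    M ≤ ((Finset.Icc 1 M).filter fun j : ℕ => (j : ℤ) + r ∈ Set.Icc 1 (M : ℤ)).card + 2 * r.natAbs ∧
    ((Finset.Icc 1 M).filter fun j : ℕ => (j : ℤ) + r ∈ Set.Icc 1 (M : ℤ)).card ≤ M := by
  constructor
  · have h : Finset.Icc (1 + r.natAbs) (M - r.natAbs) ⊆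
        (Finset.Icc 1 M).filter fun j : ℕ => (j : ℤ) + r ∈ Set.Icc 1 (M : ℤ) := by
      intro j hj
      rw [Finset.mem_Icc] at hj
      rw [Finset.mem_filter, Finset.mem_Icc, Set.mem_Icc]
      omega
    have := Finset.card_le_card h
    rw [Nat.card_Icc] at this
    omega
  · refine (Finset.card_filter_le _ _).trans ?_
    simp

/-- If m divides k, with quotient r, the mean counts the pairs with l = j + r, about M of them, and
the limit is π. Otherwise no pair contributes, and the sum of powers of a nontrivial m-th root of
unity in `wallLimit` vanishes as well. -/
theorem tendsto_wallMean_fourier {m : ℕ} (hm : 1 ≤ m) (k : ℤ) :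
    Tendsto (fun M => wallMean M m (fourier k)) atTop (𝓝 (wallLimit m (fourier k))) := by
  have hm0 : (m : ℤ) ≠ 0 := by omega
  have hmc : (m : ℂ) ≠ 0 := by exact_mod_cast hm0
  have hπ := Complex.ofReal_ne_zero.2 Real.pi_ne_zero
  have e1 : ∀ M, wallMean M m (fourier k) = 1 / M * ∑ j ∈ Finset.Icc 1 M, ∑ l ∈ Finset.Icc 1 M,
      if (m * ((j : ℤ) - l) + k : ℤ) = 0 then (Real.pi : ℂ) else 0 := by
    intro M
    rw [← integral_wallFactor_mul_exp, wallMean]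
    simp only [fourier_pi_apply]
  have e2 : wallLimit m (fourier k) = Real.pi / m * ∑ j ∈ Finset.range m,
      Complex.exp (2 * Real.pi * Complex.I * (k / m)) ^ j := by
    rw [wallLimit]
    congr 1
    refine Finset.sum_congr rfl fun j _ => ?_
    rw [fourier_pi_apply, ← Complex.exp_nat_mul]
    congr 1
    push_cast
    field_simp
  by_cases hk : (m : ℤ) ∣ k
  · obtain ⟨r, rfl⟩ := hk
    have e3 : wallLimit m (fourier (m * r)) = Real.pi := by
      rw [e2]
      have : Complex.exp (2 * Real.pi * Complex.I * (((m * r : ℤ) : ℂ) / m)) = 1 := by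
        rw [Complex.exp_eq_one_iff]
        exact ⟨r, by push_cast; field_simp⟩
      simp only [this, one_pow, Finset.sum_const, Finset.card_range, nsmul_eq_mul, mul_one]
      field_simp
    rw [e3]
    have e4 : ∀ M, wallMean M m (fourier (m * r)) = ((((((Finset.Icc 1 M).filter fun j : ℕ =>
        (j : ℤ) + r ∈ Set.Icc 1 (M : ℤ)).card : ℝ) / M) * Real.pi : ℝ) : ℂ) := by
      intro M
      rw [e1]
      have : ∀ j ∈ Finset.Icc 1 M, (∑ l ∈ Finset.Icc 1 M,
          if (m * ((j : ℤ) - l) + m * r : ℤ) = 0 then (Real.pi : ℂ) else 0) =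
          if (j : ℤ) + r ∈ Set.Icc 1 (M : ℤ) then (Real.pi : ℂ) else 0 := by
        intro j _
        have h1 : ∀ l : ℕ, (m * ((j : ℤ) - l) + m * r : ℤ) = 0 ↔ (l : ℤ) = j + r := by
          intro l
          rw [← mul_add, mul_eq_zero, or_iff_right hm0]
          omega
        simp only [h1]
        split_ifs with h
        · obtain ⟨l, hl⟩ := Int.eq_ofNat_of_zero_le (zero_le_one.trans h.1)
          rw [hl] at h ⊢
          simp only [Nat.cast_inj, Finset.sum_ite_eq']
          rw [if_pos]
          rw [Set.mem_Icc] at h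
          rw [Finset.mem_Icc]
          omega
        · refine Finset.sum_eq_zero fun l hl => if_neg fun h' => h ?_
          rw [Finset.mem_Icc] at hl
          rw [← h', Set.mem_Icc]
          omega
      rw [Finset.sum_congr rfl this, ← Finset.sum_filter, Finset.sum_const, nsmul_eq_mul]
      push_cast
      ring
    simp_rw [e4]
    refine (Complex.continuous_ofReal.tendsto _).comp ?_
    suffices h : Tendsto (fun M : ℕ => (((Finset.Icc 1 M).filter fun j : ℕ =>
        (j : ℤ) + r ∈ Set.Icc 1 (M : ℤ)).card : ℝ) / M) atTop (𝓝 1) by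
      simpa only [one_mul] using h.mul_const Real.pi
    have hlow : Tendsto (fun M : ℕ => 1 - (2 * r.natAbs : ℝ) / M) atTop (𝓝 1) := by
      have := (tendsto_const_div_atTop_nhds_zero_nat (2 * r.natAbs : ℝ)).const_sub 1
      rwa [sub_zero] at this
    refine tendsto_of_tendsto_of_tendsto_of_le_of_le' hlow tendsto_const_nhds ?_ ?_
    · filter_upwards [eventually_gt_atTop 0] with M hM
      have hM' : (0 : ℝ) < M := by exact_mod_cast hM
      have h := (card_shift_bounds M r).1
      have h' : (M : ℝ) ≤ ((Finset.Icc 1 M).filter fun j : ℕ =>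
        (j : ℤ) + r ∈ Set.Icc 1 (M : ℤ)).card + 2 * r.natAbs := by exact_mod_cast h
      rw [le_div_iff₀ hM', sub_mul, div_mul_cancel₀ _ hM'.ne', one_mul]
      linarith
    · filter_upwards [eventually_gt_atTop 0] with M hM
      have hM' : (0 : ℝ) < M := by exact_mod_cast hM
      rw [div_le_one hM']
      exact_mod_cast (card_shift_bounds M r).2
  · have e3 : wallLimit m (fourier k) = 0 := by
      rw [e2]
      set ζ := Complex.exp (2 * Real.pi * Complex.I * (k / m)) with hζ
      have h1 : ζ ^ m = 1 := by
        rw [hζ, ← Complex.exp_nat_mul, Complex.exp_eq_one_iff]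
        exact ⟨k, by field_simp⟩
      have h2 : ζ ≠ 1 := by
        rw [hζ, Ne, Complex.exp_eq_one_iff]
        rintro ⟨n, hn⟩
        apply hk
        refine ⟨n, ?_⟩
        have h3 : (k : ℂ) = m * n := by
          have h4 : (2 * Real.pi * Complex.I : ℂ) ≠ 0 := Complex.two_pi_I_ne_zero
          have h5 : (k / m : ℂ) = n := by
            apply mul_left_cancel₀ h4
            rw [hn]; ring
          rw [← h5]; field_simp
        exact_mod_cast h3
      have h3 := mul_geom_sum ζ m
      rw [h1, sub_self, mul_eq_zero, sub_eq_zero] at h3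
      rw [h3.resolve_left h2, mul_zero]
    rw [e3]
    refine tendsto_const_nhds.congr fun M => ?_
    rw [e1]
    rw [Finset.sum_eq_zero, mul_zero]
    intro j _
    refine Finset.sum_eq_zero fun l _ => if_neg fun h => hk ⟨l - j, ?_⟩
    linear_combination h

/-- Density of trigonometric polynomials, plus the bound π‖g‖ on both functionals, uniform in M. -/
theorem tendsto_wallMean {m : ℕ} (hm : 1 ≤ m) (g : C(AddCircle Real.pi, ℂ)) :
    Tendsto (fun M => wallMean M m g) atTop (𝓝 (wallLimit m g)) := by
  have hspan : ∀ f ∈ Submodule.span ℂ (Set.range (fourier (T := Real.pi))),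
      Tendsto (fun M => wallMean M m f) atTop (𝓝 (wallLimit m f)) := by
    intro f hf
    induction hf using Submodule.span_induction with
    | mem f hf => obtain ⟨k, rfl⟩ := hf; exact tendsto_wallMean_fourier hm k
    | zero =>
      have h1 : ∀ M, wallMean M m 0 = 0 := fun M => by simp [wallMean]
      have h2 : wallLimit m 0 = 0 := by simp [wallLimit]
      simp only [h1, h2, tendsto_const_nhds]
    | add f g _ _ hf hg => simp only [wallMean_add, wallLimit_add]; exact hf.add hg
    | smul c f _ hf => simp only [wallMean_smul, wallLimit_smul]; exact hf.const_mul c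
  have hg : g ∈ closure (Submodule.span ℂ (Set.range (fourier (T := Real.pi))) : Set _) := by
    have h := span_fourier_closure_eq_top (T := Real.pi)
    have : g ∈ (Submodule.span ℂ (Set.range (fourier (T := Real.pi)))).topologicalClosure := by
      rw [h]; trivial
    exact this
  have hπ := Real.pi_pos
  rw [Metric.tendsto_atTop]
  intro ε hε
  obtain ⟨f, hf, hfg⟩ := Metric.mem_closure_iff.1 hg (ε / (3 * Real.pi)) (by positivity)
  obtain ⟨M₀, hM₀⟩ := Metric.tendsto_atTop.1 (hspan f hf) (ε / 3) (by positivity)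
  refine ⟨M₀, fun M hM => ?_⟩
  have h1 := hM₀ M hM
  rw [dist_eq_norm] at h1 hfg ⊢
  have eg : g = f + (g - f) := by abel
  have h2 := norm_wallMean_le M hm (g - f)
  have h3 := norm_wallLimit_le hm (g - f)
  have h4 : Real.pi * ‖g - f‖ < ε / 3 := by
    calc Real.pi * ‖g - f‖ < Real.pi * (ε / (3 * Real.pi)) := by gcongr
      _ = ε / 3 := by field_simp
  rw [eg, wallMean_add, wallLimit_add, add_sub_add_comm]
  calc _ ≤ ‖wallMean M m f - wallLimit m f‖ + (‖wallMean M m (g - f)‖ + ‖wallLimit m (g - f)‖) :=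
        (norm_add_le _ _).trans (by gcongr; exact norm_sub_le _ _)
    _ < ε := by linarith

theorem tendsto_integral_wallFactor_mul {m : ℕ} (hm : 1 ≤ m) {g : ℝ → ℝ} (hg : Continuous g)
    (hper : Function.Periodic g Real.pi) :
    Tendsto (fun M : ℕ => 1 / (M : ℝ) * ∫ d in 0..Real.pi, wallFactor M m d * g d) atTop
      (𝓝 (Real.pi / m * ∑ j ∈ Finset.range m, g (Real.pi * j / m))) := by
  let G : C(AddCircle Real.pi, ℂ) :=
    ⟨fun x => (hper.lift x : ℂ), Complex.continuous_ofReal.comp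
      (continuous_coinduced_dom.mpr (by exact hg))⟩
  have hG : ∀ d : ℝ, G (d : AddCircle Real.pi) = (g d : ℂ) := fun d => rfl
  have h := tendsto_wallMean hm G
  have e1 : ∀ M, wallMean M m G =
      ((1 / (M : ℝ) * ∫ d in 0..Real.pi, wallFactor M m d * g d : ℝ) : ℂ) := by
    intro M
    simp only [wallMean, hG]
    rw [Complex.ofReal_mul, ← intervalIntegral.integral_ofReal]
    push_cast
    rfl
  have e2 : wallLimit m G = ((Real.pi / m * ∑ j ∈ Finset.range m, g (Real.pi * j / m) : ℝ) : ℂ) := by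
    simp only [wallLimit, hG]
    push_cast
    rfl
  simp only [e1, e2] at h
  simpa only [Function.comp_def, Complex.ofReal_re] using (Complex.continuous_re.tendsto _).comp h

/-! ### Separating the walls -/

theorem tendsto_integral_sin_sq_mul {f : ℝ → ℝ} (hf : IntervalIntegrable f volume 0 (2 * Real.pi)) :
    Tendsto (fun n : ℕ => ∫ p in 0..2 * Real.pi, Real.sin (n * p) ^ 2 * f p) atTop
      (𝓝 (1 / 2 * ∫ p in 0..2 * Real.pi, f p)) := by
  have hπ := Real.pi_pos
  have h2π : (0 : ℝ) ≤ 2 * Real.pi := by positivity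
  have hcos : Tendsto (fun n : ℕ => ∫ p in 0..2 * Real.pi, Real.cos (2 * n * p) * f p) atTop (𝓝 0) := by
    -- With the convention exp(-2πivw) of the Fourier transform, w = n/π gives the frequency 2n.
    have hn : Tendsto (fun n : ℕ => (n : ℝ) / Real.pi) atTop (cocompact ℝ) :=
      (tendsto_natCast_atTop_atTop.atTop_div_const hπ).mono_right atTop_le_cocompact
    have hRL := (Real.tendsto_integral_exp_smul_cocompact
      ((Set.Ioc 0 (2 * Real.pi)).indicator fun p => (f p : ℂ))).comp hn
    have hre := (Complex.continuous_re.tendsto 0).comp hRL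
    rw [Complex.zero_re] at hre
    refine hre.congr fun n => ?_
    simp only [Function.comp_apply]
    have e1 : ∀ v : ℝ, (Real.fourierChar (-(v * (n / Real.pi))) : Circle) •
        (Set.Ioc 0 (2 * Real.pi)).indicator (fun p => (f p : ℂ)) v =
        (Set.Ioc 0 (2 * Real.pi)).indicator
          (fun p => Complex.exp ((-(2 * n * p) : ℝ) * Complex.I) * (f p : ℂ)) v := by
      intro v
      rw [Circle.smul_def, Real.fourierChar_apply, smul_eq_mul]
      by_cases hv : v ∈ Set.Ioc 0 (2 * Real.pi)
      · rw [Set.indicator_of_mem hv, Set.indicator_of_mem hv]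
        congr 3
        push_cast
        have := Complex.ofReal_ne_zero.2 Real.pi_ne_zero
        field_simp
      · rw [Set.indicator_of_notMem hv, Set.indicator_of_notMem hv, mul_zero]
    simp_rw [e1]
    rw [integral_indicator measurableSet_Ioc, intervalIntegral.integral_of_le h2π]
    have hint : Integrable (fun p => Complex.exp ((-(2 * n * p) : ℝ) * Complex.I) * (f p : ℂ))
        (volume.restrict (Set.Ioc 0 (2 * Real.pi))) := by
      rw [intervalIntegrable_iff_integrableOn_Ioc_of_le h2π] at hf
      refine Integrable.bdd_mul (c := 1) hf.ofReal
        (Continuous.aestronglyMeasurable (by fun_prop)) (Eventually.of_forall fun p => ?_)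
      rw [Complex.norm_exp_ofReal_mul_I]
    rw [← Complex.reCLM_apply, ← Complex.reCLM.integral_comp_comm hint]
    refine integral_congr_ae (Eventually.of_forall fun p => ?_)
    simp only [Complex.reCLM_apply, Complex.re_mul_ofReal, Complex.exp_ofReal_mul_I_re, Real.cos_neg]
  have hc : ∀ n : ℕ, IntervalIntegrable (fun p => Real.cos (2 * n * p) * f p) volume 0 (2 * Real.pi) :=
    fun n => hf.continuousOn_mul (by fun_prop)
  have h := (hcos.const_mul (1 / 2)).const_sub (1 / 2 * ∫ p in 0..2 * Real.pi, f p)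
  rw [mul_zero, sub_zero] at h
  refine h.congr fun n => ?_
  rw [← intervalIntegral.integral_const_mul, ← intervalIntegral.integral_const_mul,
    ← intervalIntegral.integral_sub (hf.const_mul _) ((hc n).const_mul _)]
  refine intervalIntegral.integral_congr fun p _ => ?_
  rw [Real.sin_sq_eq_half_sub, ← mul_assoc 2]
  ring

/-- At d = 0 the numerator degenerates too: the profile is 1/(1 + 4(1 + cos p)) where cos p ≠ 1. So
the zero frequency of the wall costs only O(1). -/
theorem profile_zero_le (p : ℝ) : profile p 0 ≤ 1 := by
  rw [profile, Real.cos_zero]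
  have h1 := Real.cos_le_one p
  have h2 := Real.neg_one_le_cos p
  refine div_le_one_of_le₀ ?_ (by nlinarith [sq_nonneg (1 - Real.cos p)])
  nlinarith [sq_nonneg (1 - Real.cos p), mul_nonneg (sq_nonneg (1 - Real.cos p))
    (by linarith : 0 ≤ 1 + Real.cos p)]

theorem intervalIntegrable_profile_fst {d : ℝ} (hd : d ∈ Set.Ico 0 Real.pi) (a c : ℝ) :
    IntervalIntegrable (fun p => profile p d) volume a c := by
  rcases hd.1.eq_or_lt with rfl | h0
  · refine IntervalIntegrable.mono_fun' (g := fun _ => 1) intervalIntegrable_const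
      (measurable_profile_fst 0).aestronglyMeasurable (Eventually.of_forall fun p => ?_)
    simp only
    rw [Real.norm_eq_abs, abs_of_nonneg (profile_nonneg _ _)]
    exact profile_zero_le p
  · exact (continuous_profile_fst (Real.sin_pos_of_mem_Ioo ⟨h0, hd.2⟩).ne').intervalIntegrable _ _

theorem tendsto_wallSymbol {d : ℝ} (hd : d ∈ Set.Ico 0 Real.pi) :
    Tendsto (fun n => wallSymbol n d) atTop (𝓝 (∫ p in 0..Real.pi, profile p d)) := by
  have h := tendsto_integral_sin_sq_mul (intervalIntegrable_profile_fst hd 0 (2 * Real.pi))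
  rw [integral_two_pi_eq (intervalIntegrable_profile_fst hd) fun p => profile_two_pi_sub p d,
    ← mul_assoc, one_div, inv_mul_cancel₀ two_ne_zero, one_mul] at h
  exact h

/-! ### The walls -/

/-- The energy per unit length of a pair of walls. -/
noncomputable def wallEnergy (n m : ℕ) : ℝ :=
  1 / (4 * √3 * Real.pi * m ^ 2) * ∑ j ∈ Finset.range m, wallSymbol n (Real.pi * j / m)

/-- Fubini writes the energy of M dipoles per wall as the integral of `wallFactor` against
`wallSymbol`; dividing by M leaves the values of the symbol at πj/m. -/
theorem isGrainEnergy_wallEnergy (n : ℕ) {m : ℕ} (hm : 1 ≤ m) :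
    IsGrainEnergy n m (wallEnergy n m) := by
  refine ⟨_, fun M _ => isLimMinEnergy_qGrain M n m, ?_⟩
  have hm' : (0 : ℝ) < m := by exact_mod_cast hm
  have hπ := Real.pi_pos
  have e1 : ∀ M : ℕ, ∫ k, ‖∑ j ∈ Finset.Icc 1 M, Complex.exp ((2 * m * k.2 : ℝ) * Complex.I) ^ j‖ ^ 2 *
      (Real.sin (n * k.1) ^ 2 * profile k.1 k.2) ∂cell =
      ∫ d in 0..Real.pi, wallFactor M m d * wallSymbol n d := by
    intro M
    have hint := integrable_mul_profile n (w := fun k => wallFactor M m k.2)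
      ((continuous_wallFactor M m).comp continuous_snd) (C := M ^ 2) (fun k => by
        rw [abs_of_nonneg (wallFactor_nonneg _ _ _)]; exact wallFactor_le _ _ _)
    rw [cell] at hint ⊢
    rw [intervalIntegral.integral_of_le hπ.le]
    refine (integral_prod_symm _ hint).trans ?_
    congr 1
    ext d
    rw [wallSymbol, intervalIntegral.integral_of_le (by positivity), ← integral_const_mul]
  have h := (tendsto_integral_wallFactor_mul hm (continuous_wallSymbol n)
    (wallSymbol_periodic n)).const_mul (1 / (4 * Real.pi ^ 2 * (√3 * m)))
  have e2 : wallEnergy n m = 1 / (4 * Real.pi ^ 2 * (√3 * m)) *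
      (Real.pi / m * ∑ j ∈ Finset.range m, wallSymbol n (Real.pi * j / m)) := by
    rw [wallEnergy]
    field_simp
  rw [e2]
  refine h.congr fun M => ?_
  rw [e1]
  rcases Nat.eq_zero_or_pos M with rfl | hM
  · simp
  · have hM' : (0 : ℝ) < M := by exact_mod_cast hM
    field_simp

/-- The energy per unit length of two walls far apart. -/
noncomputable def farWallEnergy (m : ℕ) : ℝ :=
  1 / (4 * √3 * Real.pi * m ^ 2) * ∑ j ∈ Finset.range m, ∫ p in 0..Real.pi, profile p (Real.pi * j / m)

theorem tendsto_wallEnergy (m : ℕ) :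
    Tendsto (fun n => wallEnergy n m) atTop (𝓝 (farWallEnergy m)) := by
  unfold wallEnergy farWallEnergy
  refine Tendsto.const_mul _ (tendsto_finsetSum _ fun j hj => tendsto_wallSymbol ?_)
  have hjm : (j : ℝ) < m := by exact_mod_cast Finset.mem_range.1 hj
  have hm : (0 : ℝ) < m := lt_of_le_of_lt (Nat.cast_nonneg j) hjm
  have hπ := Real.pi_pos
  refine ⟨by positivity, ?_⟩
  rw [div_lt_iff₀ hm]
  gcongr

theorem abs_harmonic_sub_log_le (m : ℕ) :
    |((harmonic m : ℚ) : ℝ) - Real.log ((m + 1 : ℕ) : ℝ)| ≤ 1 := by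
  have h1 := log_add_one_le_harmonic m
  have h2 := harmonic_le_one_add_log m
  have h3 : Real.log m ≤ Real.log ((m + 1 : ℕ) : ℝ) := by
    rcases Nat.eq_zero_or_pos m with rfl | hm
    · simp
    · exact Real.log_le_log (by exact_mod_cast hm) (by push_cast; linarith)
  rw [abs_le]
  constructor <;> linarith

theorem abs_sum_integral_profile_sub_le (m : ℕ) :
    |(∑ j ∈ Finset.range (m + 1), ∫ p in 0..Real.pi, profile p (Real.pi * j / (m + 1 : ℕ))) -
      2 * (m + 1 : ℕ) / √3 * harmonic m| ≤ 764 * (m + 1 : ℕ) := by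
  have hπ := Real.pi_pos
  have hm : (0 : ℝ) < ((m + 1 : ℕ) : ℝ) := by positivity
  set x : ℝ := ((m + 1 : ℕ) : ℝ) with hx
  have hx' : x = m + 1 := by rw [hx]; push_cast; ring
  have h0 : |∫ p in 0..Real.pi, profile p 0| ≤ 764 := by
    have : ‖∫ p in 0..Real.pi, profile p 0‖ ≤ 1 * |Real.pi - 0| :=
      intervalIntegral.norm_integral_le_of_norm_le_const fun p _ => by
        rw [Real.norm_eq_abs, abs_of_nonneg (profile_nonneg _ _)]
        exact profile_zero_le p
    rw [Real.norm_eq_abs, sub_zero, abs_of_pos hπ] at this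
    linarith [Real.pi_le_four]
  -- The singularity at d = π appears as 1/(m - 1 - j + 1), the reflection of 1/(j + 1) within
  -- `range m`, so both sums are the same harmonic number.
  have hterm : ∀ j ∈ Finset.range m,
      |(∫ p in 0..Real.pi, profile p (Real.pi * (j + 1 : ℕ) / x)) -
        x / √3 * (1 / ((j : ℝ) + 1) + 1 / (((m - 1 - j : ℕ) : ℝ) + 1))| ≤ 764 := by
    intro j hj
    have hjm := Finset.mem_range.1 hj
    have hjm' : ((j + 1 : ℕ) : ℝ) < x := by rw [hx]; exact_mod_cast (by omega : j + 1 < m + 1)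
    have h := abs_integral_profile_fst_sub_le (d := Real.pi * (j + 1 : ℕ) / x)
      ⟨by positivity, by rw [div_lt_iff₀ hm]; gcongr⟩
    have e2 : ((m - 1 - j : ℕ) : ℝ) + 1 = x - (j + 1 : ℕ) := by
      rw [hx, Nat.sub_sub, Nat.cast_sub (by omega)]
      push_cast; ring
    have e : Real.pi / √3 * (1 / (Real.pi * (j + 1 : ℕ) / x) +
        1 / (Real.pi - Real.pi * (j + 1 : ℕ) / x)) =
        x / √3 * (1 / ((j : ℝ) + 1) + 1 / (((m - 1 - j : ℕ) : ℝ) + 1)) := by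
      rw [e2]
      have h3 : x - (j + 1 : ℕ) ≠ 0 := (sub_pos.2 hjm').ne'
      have e3 : Real.pi - Real.pi * (j + 1 : ℕ) / x = Real.pi * (x - (j + 1 : ℕ)) / x := by
        field_simp
      rw [e3]
      push_cast at h3 ⊢
      field_simp
    rwa [e] at h
  have hsum : ∑ j ∈ Finset.range m, x / √3 * (1 / ((j : ℝ) + 1) + 1 / (((m - 1 - j : ℕ) : ℝ) + 1)) =
      2 * x / √3 * harmonic m := by
    rw [← Finset.mul_sum, Finset.sum_add_distrib,
      Finset.sum_range_reflect (fun j => 1 / ((j : ℝ) + 1)) m, harmonic]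
    push_cast
    simp only [one_div]
    ring
  rw [Finset.sum_range_succ', ← hsum, add_sub_right_comm, ← Finset.sum_sub_distrib]
  simp only [Nat.cast_zero, mul_zero, zero_div]
  refine (abs_add_le _ _).trans ?_
  refine (add_le_add ((Finset.abs_sum_le_sum_abs _ _).trans (Finset.sum_le_sum hterm)) h0).trans ?_
  rw [Finset.sum_const, Finset.card_range, nsmul_eq_mul, hx']
  linarith

theorem abs_farWallEnergy_sub_le {m : ℕ} (hm : 1 ≤ m) :
    |farWallEnergy m - Real.log m / (6 * Real.pi * m)| ≤ 1000 / m := by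
  obtain ⟨m, rfl⟩ := Nat.exists_eq_add_of_le' hm
  have hπ := Real.pi_gt_three
  have h3 : 1 ≤ √3 := Real.one_le_sqrt.2 (by norm_num)
  have hs : √3 ^ 2 = 3 := Real.sq_sqrt (by norm_num)
  have h1 := abs_sum_integral_profile_sub_le m
  have h2 := abs_harmonic_sub_log_le m
  rw [farWallEnergy]
  set x : ℝ := ((m + 1 : ℕ) : ℝ) with hx
  have hx0 : 0 < x := by positivity
  set S := ∑ j ∈ Finset.range (m + 1), ∫ p in 0..Real.pi, profile p (Real.pi * j / x)
  -- The factor √3 of the length per dislocation meets the √3 of the kernel integral, which gives 4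
  -- · 3/2 = 6.
  have e : 1 / (4 * √3 * Real.pi * x ^ 2) * S - Real.log x / (6 * Real.pi * x) =
      1 / (4 * √3 * Real.pi * x ^ 2) * ((S - 2 * x / √3 * harmonic m) +
        2 * x / √3 * (harmonic m - Real.log x)) := by
    have e' : Real.log x / (6 * Real.pi * x) =
        1 / (4 * √3 * Real.pi * x ^ 2) * (2 * x / √3 * Real.log x) := by
      have : 1 / (4 * √3 * Real.pi * x ^ 2) * (2 * x / √3 * Real.log x) =
          Real.log x / (2 * √3 ^ 2 * Real.pi * x) := by field_simp; norm_num
      rw [this, hs]; ring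
    rw [e']; ring
  have h4 : |2 * x / √3 * (harmonic m - Real.log x)| ≤ 2 * x * 1 := by
    rw [abs_mul, abs_of_nonneg (by positivity : 0 ≤ 2 * x / √3)]
    exact mul_le_mul (div_le_self (by positivity) h3) h2 (abs_nonneg _) (by positivity)
  rw [e, abs_mul, abs_of_nonneg (by positivity)]
  calc _ ≤ 1 / (4 * √3 * Real.pi * x ^ 2) * (764 * x + 2 * x * 1) := by
        gcongr
        exact (abs_add_le _ _).trans (add_le_add h1 h4)
    _ = 766 / (4 * √3 * Real.pi) / x := by field_simp; norm_num
    _ ≤ 1000 / x := by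
        gcongr
        rw [div_le_iff₀ (by positivity)]
        nlinarith

end ArizaOrtiz

theorem theorem3 :
    ∃ (Edip : ℕ → ℝ) (Egrain : ℕ → ℕ → ℝ) (γ : ℕ → ℝ),
      (∀ n, 1 ≤ n → ArizaOrtiz.IsLimMinEnergy (ArizaOrtiz.qDip n) (Edip n)) ∧
      (∀ n m, 1 ≤ n → 1 ≤ m → ArizaOrtiz.IsGrainEnergy n m (Egrain n m)) ∧
      (∀ m, 1 ≤ m → Tendsto (fun n => Egrain n m) atTop (𝓝 (γ m))) ∧
      (∃ C : ℝ, ∀ n : ℕ, 1 ≤ n →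
        |Edip n - Real.log n / (2 * Real.pi * √3)| ≤ C) ∧
      (∃ C : ℝ, ∀ m : ℕ, 1 ≤ m →
        |γ m - Real.log m / (6 * Real.pi * m)| ≤ C / m) :=
  ⟨_, ArizaOrtiz.wallEnergy, ArizaOrtiz.farWallEnergy,
    fun n _ => ArizaOrtiz.isLimMinEnergy_qDip n,
    fun n _ _ hm => ArizaOrtiz.isGrainEnergy_wallEnergy n hm,
    fun m _ => ArizaOrtiz.tendsto_wallEnergy m,
    ⟨3200, fun _ hn => ArizaOrtiz.abs_dipole_sub_log_le hn⟩,
    ⟨1000, fun _ hm => ArizaOrtiz.abs_farWallEnergy_sub_le hm⟩⟩
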